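/- Let $v,k$ be integers with $k\ge 2$ and $v-k\ge 2$, and let $d=\binom v2$. Index the coordinates of $\mathbb R^d$ by the two-element subsets $\{i,j\}$ of $\{1,\dots,v\}$. Let $V_{v,k}$ be the set of vectors $y\in\{0,1\}^v$ with exactly $k$ entries equal to $1$, and let $Z(y)\in\mathbb R^d$ have coordinates $Z(y)_{\{i,j\}}=y_iy_j$. Let $\xi_1,\xi_2,\dots$ be independent and uniformly distributed on $V_{v,k}$, and put $X_t=\sum_{s=1}^t Z(\xi_s)$, $Y_t=X_t-\frac{k(k-1)}{v(v-1)}\,t\,\vec 1$ and $\mathbb P^{(t)}_{v,k}(\vec 0,\vec 0)=\mathbb P(Y_t=\vec 0)$. Put $C_j=\prod_{i=0}^{j-1}\frac{k-i}{v-i}$ for $j=2,3,4$. Let $N$ be the $d\times d$ matrix whose entry $N_{\{a,b\},\{c,e\}}$ equals $C_2-C_2^2$, $C_3-C_2^2$ or $C_4-C_2^2$ according to whether $|\{a,b\}\cap\{c,e\}|$ is $2$, $1$ or $0$, and let $M$ be the $(d-1)\times(d-1)$ matrix obtained from $N$ by deleting the row and the column with index $\{v-1,v\}$. Then $M$ has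 a positive definite square root $P$ (symmetric and positive definite, with $P^2=M$), and there are constants $D_1,D_2>0$, depending only on $v$ and $k$, such that $$[-D_1r,D_1r]^{d-1}\subseteq P[-r,r]^{d-1}\subseteq[-D_2r,D_2r]^{d-1}\qquad\text{for all } r>0. \tag{1}$$ For any constants $D_1,D_2>0$ that satisfy (1), define $$L(v,k,t,\delta)=\left[1+t^2(d\delta)^6\right]^{-1/2}\left[1-\tfrac13(d\delta)^4\right]^t\left[1-e^{-\frac12t(D_1\delta)^2}\right]^{(d-1)/2},$$ $$U(v,k,t,\delta)=\left[1+\tfrac14(d\delta)^6\right]^{t/2}\left[1+\tfrac13(d\delta)^4\right]^t\left[1-e^{-t(2D_2\delta)^2}\right]^{(d-1)/2}.$$ Suppose that $0<\delta<k^{-2}\binom vk^{-2}\left[\frac1{6\cdot96^2}\left(\frac{2\pi}{k-1}\right)^4\right]$, and let $t\ge2$ be an integer with $t<2(d\delta)^{-3}$. (a) If $t\frac{k(k-1)}{v(v-1)}\notin\mathbb Z$, then $\mathbb P^{(t)}_{v,k}(\vec 0,\vec 0)=0$. (b) If $t\frac{k(k-1)}{v(v-1)}\in\mathbb Z$ but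 $t\frac kv\notin\mathbb Z$, then $$\mathbb P^{(t)}_{v,k}(\vec 0,\vec 0)\le\exp\left(-\binom vk^{-1}\frac{11}{768}\,t\delta^2\right).$$ (c) If $t\frac{k(k-1)}{v(v-1)}\in\mathbb Z$ and $t\frac kv\in\mathbb Z$, then $$\mathbb P^{(t)}_{v,k}(\vec 0,\vec 0)\le\frac{(k-1)^{v-1}}{\sqrt{(2\pi t)^{d-1}\det(M)}}\,U(v,k,t,\delta)+e^{-\binom vk^{-1}\frac{11}{768}t\delta^2}$$ and $$\mathbb P^{(t)}_{v,k}(\vec 0,\vec 0)\ge\frac{(k-1)^{v-1}}{\sqrt{(2\pi t)^{d-1}\det(M)}}\,L(v,k,t,\delta)-e^{-\binom vk^{-1}\frac{11}{768}t\delta^2}.$$ -/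

import Mathlib

namespace BIBDWalk

open MeasureTheory ProbabilityTheory

/-- The set `V_{v,k}` of vectors with `k` entries equal to `1` and `v - k` entries equal to `0`. -/
abbrev Column (v k : ℕ) : Type := {y : Fin v → Fin 2 // ∑ i, (y i : ℕ) = k}

/-- The coordinate index set of `ℝ^d`: the two-element subsets of `{1, …, v}`. -/
abbrev Pair (v : ℕ) : Type := {S : Finset (Fin v) // S.card = 2}

/-- The dimension `d = v(v-1)/2`. -/
def dim (v : ℕ) : ℕ := v.choose 2

/-- The vector `Z(y)`, whose coordinate with index `{i, j}` is `y_i y_j`. -/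
def Z {v k : ℕ} (y : Column v k) : Pair v → ℝ := fun S => ∏ i ∈ S.1, ((y.1 i : ℕ) : ℝ)

/-- The law of an infinite sequence of independent, uniformly distributed elements of `V_{v,k}`. -/
noncomputable def walkMeasure (v k : ℕ) : Measure (ℕ → Column v k) :=
  Measure.infinitePi fun _ : ℕ => uniformOn (Set.univ : Set (Column v k))

/-- The random walk `X_t`, started at the origin, with increments `Z(y)`. -/
def X {v k : ℕ} (t : ℕ) (ω : ℕ → Column v k) : Pair v → ℝ := ∑ s ∈ Finset.range t, Z (ω s)

/-- The centered random walk `Y_t = X_t - (k(k-1) / (v(v-1))) t (1, …, 1)`. -/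
noncomputable def Y {v k : ℕ} (t : ℕ) (ω : ℕ → Column v k) : Pair v → ℝ :=
  fun S => X t ω S - ((k : ℝ) * (k - 1)) / ((v : ℝ) * (v - 1)) * t

/-- The probability that `Y_t = 0`. -/
noncomputable def returnProb (v k t : ℕ) : ℝ :=
  (walkMeasure v k).real {ω | Y t ω = 0}

/-- `C_j = k(k-1)⋯(k-j+1) / (v(v-1)⋯(v-j+1))`. -/
noncomputable def coeffC (v k j : ℕ) : ℝ :=
  (∏ i ∈ Finset.range j, ((k : ℝ) - i)) / ∏ i ∈ Finset.range j, ((v : ℝ) - i)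

/-- The `d × d` matrix `N`. -/
noncomputable def matN (v k : ℕ) : Matrix (Pair v) (Pair v) ℝ :=
  Matrix.of fun S T =>
    if (S.1 ∩ T.1).card = 2 then coeffC v k 2 - coeffC v k 2 ^ 2
    else if (S.1 ∩ T.1).card = 1 then coeffC v k 3 - coeffC v k 2 ^ 2
    else coeffC v k 4 - coeffC v k 2 ^ 2

/-- The last pair `{v-1, v}`; with indices starting at `0` it consists of `v-2` and `v-1`. -/
def lastPair (v : ℕ) : Finset (Fin v) := Finset.univ.filter fun i => v ≤ i.val + 2

/-- The indices of `ℝ^{d-1}`: all pairs other than the last one. -/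
abbrev Pair' (v : ℕ) : Type := {S : Pair v // S.1 ≠ lastPair v}

/-- The matrix `M`: the matrix `N` without the row and the column of the last pair. -/
noncomputable def matM (v k : ℕ) : Matrix (Pair' v) (Pair' v) ℝ :=
  (matN v k).submatrix Subtype.val Subtype.val

/-- The box `[-r, r]^{d-1}`. -/
def box (v : ℕ) (r : ℝ) : Set (Pair' v → ℝ) := {x | ∀ S, |x S| ≤ r}

/-- `D₁, D₂` are positive and `[-D₁δ, D₁δ]^{d-1} ⊆ P [-δ, δ]^{d-1} ⊆ [-D₂δ, D₂δ]^{d-1}` for all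
`δ > 0`, where `P` is the (unique) positive definite square root of `M`. -/
def IsScalingPair (v k : ℕ) (D₁ D₂ : ℝ) : Prop :=
  0 < D₁ ∧ 0 < D₂ ∧ ∃ P : Matrix (Pair' v) (Pair' v) ℝ, P.PosDef ∧ P * P = matM v k ∧
    ∀ δ : ℝ, 0 < δ →
      box v (D₁ * δ) ⊆ P.mulVec '' box v δ ∧ P.mulVec '' box v δ ⊆ box v (D₂ * δ)

/-- The factor `L(v, k, t, δ)`. -/
noncomputable def factorL (v t : ℕ) (D₁ δ : ℝ) : ℝ :=
  (1 + (t : ℝ) ^ 2 * ((dim v : ℝ) * δ) ^ 6) ^ (-(1 / 2) : ℝ)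
    * (1 - 1 / 3 * ((dim v : ℝ) * δ) ^ 4) ^ t
    * (1 - Real.exp (-(1 / 2) * (t : ℝ) * (D₁ * δ) ^ 2)) ^ (((dim v : ℝ) - 1) / 2)

/-- The factor `U(v, k, t, δ)`. -/
noncomputable def factorU (v t : ℕ) (D₂ δ : ℝ) : ℝ :=
  (1 + 1 / 4 * ((dim v : ℝ) * δ) ^ 6) ^ ((t : ℝ) / 2)
    * (1 + 1 / 3 * ((dim v : ℝ) * δ) ^ 4) ^ t
    * (1 - Real.exp (-(t : ℝ) * (2 * D₂ * δ) ^ 2)) ^ (((dim v : ℝ) - 1) / 2)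

/-- The leading term `(k-1)^{v-1} / sqrt((2πt)^{d-1} det M)`. -/
noncomputable def mainTerm (v k t : ℕ) : ℝ :=
  ((k : ℝ) - 1) ^ (v - 1) / Real.sqrt ((2 * Real.pi * t) ^ (dim v - 1) * (matM v k).det)

/-- The error term `exp(-(v choose k)⁻¹ (11/768) t δ²)`. -/
noncomputable def errorTerm (v k t : ℕ) (δ : ℝ) : ℝ :=
  Real.exp (-((v.choose k : ℝ)⁻¹ * (11 / 768) * t * δ ^ 2))

end BIBDWalk

/-! The proof is a Fourier inversion on a torus with finitely many, equally strong major arcs.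

Every `Z y` has coordinate sum `k.choose 2`, so the last coordinate of `Y_t` is determined by the
others and the inversion runs over `(ℝ/2πℤ)^(d-1)` (`returnProb_eq_integral`). The integrand is
`stepChar ^ t` times the phase that targets the common value `l = t C₂` of all coordinates of `X_t`.

Extend a torus point `θ` by zero to the last pair `{p, q}`. Then `stepChar` averages `exp(i s_K)`
over the `k`-sets `K`, where `s_K` is the sum of `θ` over the pairs in `K`; its modulus is one
exactly when all `s_K` agree. Exchanging one or two points of `K` shows that if they agree up to
`η`, with `η` small, then `θ_{a,b}` is within `4η` of `g a + g b - g q`, where `g` is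
`(k-1)`-torsion and `g p = 0` (`exists_center_near`). There are `(k-1)^(v-1)` such centers, and they
are well separated. Hence outside the `δ`-balls around them some two `s_K` differ by more than
`δ/4`, and `stepChar` loses a definite amount (`norm_stepChar_le`); this is the error term.

When `t k / v` is also an integer, translation by a center leaves the integrand unchanged
(`integrand_center_add`), so all balls contribute equally; this is the factor `(k-1)^(v-1)`. In the
ball around zero the integrand is `avgExp (centeredForm θ) ^ t`, the characteristic function of a
centered variable with variance `θᵀMθ`. Taylor bounds compare it with `exp(-t θᵀMθ / 2)`. The
substitution `w = Pθ` turns the ball into a set between two cubes, and on a cube the Gaussian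
integral is a power of a one-dimensional one, bounded by comparing a square with discs.

In the other two cases the probability is zero: `Y_t = 0` makes both `t k(k-1)/(v(v-1))` and `t k/v`
counts of columns. -/

namespace BIBDWalk

open MeasureTheory ProbabilityTheory

/-! ### Sums over the pairs inside a `k`-set -/

section PairSums

variable {ι A : Type*} [DecidableEq ι]

/-- The sum of `f` over all two-element subsets of `K`. -/
def pairSum [AddCommMonoid A] (f : Finset ι → A) (K : Finset ι) : A :=
  ∑ S ∈ K.powersetCard 2, f S

theorem pairSum_insert [AddCommMonoid A] (f : Finset ι → A) {K : Finset ι} {a : ι} (ha : a ∉ K) :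
    pairSum f (insert a K) = pairSum f K + ∑ i ∈ K, f {a, i} := by
  unfold pairSum
  rw [Finset.powersetCard_succ_insert ha, Finset.sum_union, Finset.powersetCard_one]
  · congr 1
    rw [Finset.map_eq_image, Finset.image_image, Finset.sum_image]
    · rfl
    · intro x hx y hy hxy
      have hxa : x ≠ a := fun h => ha (h ▸ hx)
      have : x ∈ ({a, y} : Finset ι) := by
        have h : ({a, x} : Finset ι) = {a, y} := hxy
        rw [← h]; simp
      simpa [hxa] using this
  · rw [Finset.disjoint_left]
    intro S hS hS'
    obtain ⟨U, -, rfl⟩ := Finset.mem_image.1 hS'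
    exact ha ((Finset.mem_powersetCard.1 hS).1 (Finset.mem_insert_self _ _))

/-- In this second difference the pairs inside `K` and the pairs joining one exchanged point to `K`
all cancel. -/
theorem pairSum_tetrad [AddCommGroup A] (f : Finset ι → A) {K : Finset ι} {a b c e : ι}
    (hac : a ≠ c) (hae : a ≠ e) (hbc : b ≠ c) (hbe : b ≠ e)
    (ha : a ∉ K) (hb : b ∉ K) (hc : c ∉ K) (he : e ∉ K) :
    (pairSum f (insert a (insert c K)) - pairSum f (insert b (insert c K))) -
      (pairSum f (insert a (insert e K)) - pairSum f (insert b (insert e K))) =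
    (f {a, c} - f {b, c}) - (f {a, e} - f {b, e}) := by
  rw [pairSum_insert f (a := a) (K := insert c K) (by simp [hac, ha]),
    pairSum_insert f (a := b) (K := insert c K) (by simp [hbc, hb]),
    pairSum_insert f (a := a) (K := insert e K) (by simp [hae, ha]),
    pairSum_insert f (a := b) (K := insert e K) (by simp [hbe, hb]),
    Finset.sum_insert hc, Finset.sum_insert hc, Finset.sum_insert he, Finset.sum_insert he]
  abel

variable [Fintype ι] [SeminormedAddCommGroup A] {k : ℕ} {η : ℝ} {f : Finset ι → A}

theorem norm_tetrad_le (hk : 2 ≤ k) (hι : k + 2 ≤ Fintype.card ι) (hη : 0 ≤ η)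
    (H : ∀ K L : Finset ι, K.card = k → L.card = k → ‖pairSum f K - pairSum f L‖ ≤ η)
    {a b c e : ι} (hab : a ≠ b) (hac : a ≠ c) (hae : a ≠ e) (hbc : b ≠ c) (hbe : b ≠ e) :
    ‖(f {a, c} - f {b, c}) - (f {a, e} - f {b, e})‖ ≤ 2 * η := by
  by_cases hce : c = e
  · subst hce; simpa using hη
  have h4 : ({a, b, c, e} : Finset ι).card = 4 := by
    simp [Finset.card_insert_of_notMem, hab, hac, hae, hbc, hbe, hce]
  obtain ⟨K, hK, hKc⟩ := Finset.exists_subset_card_eq (s := ({a, b, c, e} : Finset ι)ᶜ) (n := k - 2)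
    (by rw [Finset.card_compl, h4]; omega)
  have hn : ∀ x ∈ ({a, b, c, e} : Finset ι), x ∉ K := fun x hx hxK =>
    Finset.mem_compl.1 (hK hxK) hx
  have ha := hn a (by simp)
  have hb := hn b (by simp)
  have hc := hn c (by simp)
  have he := hn e (by simp)
  have card : ∀ x y, x ≠ y → x ∉ K → y ∉ K → (insert x (insert y K)).card = k := by
    intro x y hxy hx hy
    rw [Finset.card_insert_of_notMem (by simp [hxy, hx]), Finset.card_insert_of_notMem hy]
    omega
  rw [← pairSum_tetrad f hac hae hbc hbe ha hb hc he]
  refine (norm_sub_le _ _).trans ?_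
  have h1 := H _ _ (card a c hac ha hc) (card b c hbc hb hc)
  have h2 := H _ _ (card a e hae ha he) (card b e hbe hb he)
  linarith

/-- Replacing `a` by `b` in a `k`-set changes the sum by `k - 1` differences `f {a, i} - f {b, i}`.
By the tetrad bound each is within `2η` of the one at `j`, so the total change is nearly `k - 1`
copies of it. -/
theorem norm_nsmul_swap_le (hk : 2 ≤ k) (hι : k + 2 ≤ Fintype.card ι) (hη : 0 ≤ η)
    (H : ∀ K L : Finset ι, K.card = k → L.card = k → ‖pairSum f K - pairSum f L‖ ≤ η)
    {a b j : ι} (hab : a ≠ b) (haj : a ≠ j) (hbj : b ≠ j) :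
    ‖(k - 1) • (f {a, j} - f {b, j})‖ ≤ ((k - 1 : ℕ) : ℝ) * (2 * η) := by
  have h3 : ({a, b, j} : Finset ι).card = 3 := by
    simp [Finset.card_insert_of_notMem, hab, haj, hbj]
  obtain ⟨K, hK, hKc⟩ := Finset.exists_subset_card_eq (s := ({a, b, j} : Finset ι)ᶜ) (n := k - 2)
    (by rw [Finset.card_compl, h3]; omega)
  have hn : ∀ x ∈ ({a, b, j} : Finset ι), x ∉ K := fun x hx hxK =>
    Finset.mem_compl.1 (hK hxK) hx
  have ha := hn a (by simp)
  have hb := hn b (by simp)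
  have hj := hn j (by simp)
  have hjc : (insert j K).card = k - 1 := by
    rw [Finset.card_insert_of_notMem hj]; omega
  have ha' : a ∉ insert j K := by simp [haj, ha]
  have hb' : b ∉ insert j K := by simp [hbj, hb]
  have h1 := H (insert a (insert j K)) (insert b (insert j K))
    (by rw [Finset.card_insert_of_notMem ha', hjc]; omega)
    (by rw [Finset.card_insert_of_notMem hb', hjc]; omega)
  have key : (k - 1) • (f {a, j} - f {b, j}) =
      (pairSum f (insert a (insert j K)) - pairSum f (insert b (insert j K)))
      - ∑ i ∈ K, ((f {a, i} - f {b, i}) - (f {a, j} - f {b, j})) := by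
    rw [pairSum_insert f ha', pairSum_insert f hb', Finset.sum_insert hj, Finset.sum_insert hj,
      Finset.sum_sub_distrib, Finset.sum_sub_distrib, Finset.sum_const, hKc]
    have : k - 1 = (k - 2) + 1 := by omega
    rw [this, add_smul, one_smul]
    abel
  rw [key]
  refine (norm_sub_le _ _).trans ?_
  have h2 : ‖∑ i ∈ K, ((f {a, i} - f {b, i}) - (f {a, j} - f {b, j}))‖ ≤ ∑ i ∈ K, (2 * η) := by
    refine norm_sum_le_of_le _ fun i hi => ?_
    have hia : a ≠ i := fun h => ha (h ▸ hi)
    have hib : b ≠ i := fun h => hb (h ▸ hi)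
    exact norm_tetrad_le hk hι hη H hab hia haj hib hbj
  rw [Finset.sum_const, hKc, nsmul_eq_mul] at h2
  have : ((k - 1 : ℕ) : ℝ) = ((k - 2 : ℕ) : ℝ) + 1 := by
    have : k - 1 = (k - 2) + 1 := by omega
    rw [this]; push_cast; ring
  rw [this]
  linarith

/-- If all sums over `k`-sets agree and one pair has value zero then all pairs have value zero. -/
theorem eq_zero_of_pairSum_const {f : Finset ι → ℝ} (hk : 2 ≤ k) (hι : k + 2 ≤ Fintype.card ι)
    (H : ∀ K L : Finset ι, K.card = k → L.card = k → pairSum f K = pairSum f L)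
    {p q : ι} (hpq : p ≠ q) (h0 : f {p, q} = 0) {a b : ι} (hab : a ≠ b) : f {a, b} = 0 := by
  have swap : ∀ a b j : ι, a ≠ j → b ≠ j → f {a, j} = f {b, j} := by
    intro a b j haj hbj
    by_cases hab : a = b
    · rw [hab]
    have h := norm_nsmul_swap_le (f := f) (η := 0) hk hι le_rfl
      (fun K L hK hL => by rw [H K L hK hL]; simp)
      hab haj hbj
    rw [mul_zero, mul_zero, norm_le_zero_iff, smul_eq_zero] at h
    rcases h with h | h
    · omega
    · linarith
  by_cases hbp : b = p
  · subst hbp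
    rw [swap a q b hab hpq.symm, Finset.pair_comm, h0]
  · rw [swap a p b hab (Ne.symm hbp), Finset.pair_comm]
    by_cases hbq : b = q
    · rw [hbq, Finset.pair_comm, h0]
    · rw [swap b q p hbp hpq.symm, Finset.pair_comm, h0]

end PairSums

/-! ### Torsion of the circle and functions with nearly equal `k`-sums -/

instance fact_two_pi_pos : Fact ((0 : ℝ) < 2 * Real.pi) := ⟨Real.two_pi_pos⟩

/-- The circle `ℝ / 2πℤ`. -/
abbrev Circ : Type := AddCircle (2 * Real.pi)

theorem exists_real_lift (u : Circ) : ∃ x : ℝ, (x : Circ) = u ∧ |x| = ‖u‖ := by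
  induction u using QuotientAddGroup.induction_on with
  | H y =>
    refine ⟨y - round ((2 * Real.pi)⁻¹ * y) * (2 * Real.pi), ?_, ?_⟩
    · rw [AddCircle.coe_sub, sub_eq_self]
      exact (AddCircle.coe_eq_zero_iff _).2 ⟨round ((2 * Real.pi)⁻¹ * y), by simp⟩
    · exact (AddCircle.norm_eq (2 * Real.pi)).symm

theorem norm_coe_le (x : ℝ) : ‖(x : Circ)‖ ≤ |x| :=
  QuotientAddGroup.norm_mk_le_norm (S := AddSubgroup.zmultiples (2 * Real.pi)) (m := x)

/-- If `x` is the shortest real lift of `n • u`, then `u - x / n` is torsion. -/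
theorem exists_torsion_near {n : ℕ} (hn : 0 < n) {u : Circ} {c : ℝ} (h : ‖n • u‖ ≤ n * c) :
    ∃ g : Circ, n • g = 0 ∧ ‖u - g‖ ≤ c := by
  obtain ⟨x, hx, hx'⟩ := exists_real_lift (n • u)
  have hn' : (0 : ℝ) < n := by exact_mod_cast hn
  refine ⟨u - ((x / n : ℝ) : Circ), ?_, ?_⟩
  · rw [smul_sub, ← hx, ← AddCircle.coe_nsmul, ← AddCircle.coe_sub, nsmul_eq_mul,
      mul_div_cancel₀ _ hn'.ne', sub_self, AddCircle.coe_zero]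
  · rw [sub_sub_cancel]
    refine (norm_coe_le _).trans ?_
    rw [abs_div, hx', Nat.abs_cast, div_le_iff₀ hn']
    exact h.trans_eq (mul_comm _ _)

theorem eq_zero_of_torsion {n : ℕ} (hn : 0 < n) {g : Circ} (hg : n • g = 0)
    (h : ‖g‖ < 2 * Real.pi / n) : g = 0 := by
  obtain ⟨x, rfl, hx'⟩ := exists_real_lift g
  have hn' : (0 : ℝ) < n := by exact_mod_cast hn
  rw [← AddCircle.coe_nsmul, AddCircle.coe_eq_zero_iff] at hg
  obtain ⟨m, hm⟩ := hg
  rw [nsmul_eq_mul, zsmul_eq_mul] at hm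
  rw [← hx', lt_div_iff₀ hn', mul_comm, ← Nat.abs_cast n, ← abs_mul, ← hm, abs_mul,
    abs_of_pos Real.two_pi_pos] at h
  have h1 : |(m : ℝ)| < 1 := by
    by_contra hc
    push Not at hc
    nlinarith [Real.two_pi_pos]
  have : m = 0 := by
    rw [← Int.cast_abs] at h1
    have : |m| < 1 := by exact_mod_cast h1
    exact Int.abs_lt_one_iff.1 this
  subst this
  have : x = 0 := by
    have : (n : ℝ) * x = 0 := by rw [← hm]; simp
    rcases mul_eq_zero.1 this with h | h
    · exact absurd h hn'.ne'
    · exact h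
  simp [this]

/-- A function on pairs whose sums over `k`-sets nearly agree is close to a function of the form
`{a, b} ↦ g a + g b - g q` with `g` torsion. -/
theorem exists_center_near {ι : Type*} [DecidableEq ι] [Fintype ι] {k : ℕ} {η : ℝ}
    {f : Finset ι → Circ} (hk : 2 ≤ k) (hι : k + 2 ≤ Fintype.card ι) (hη : 0 ≤ η)
    (hηk : 6 * η < 2 * Real.pi / (k - 1 : ℕ))
    (H : ∀ K L : Finset ι, K.card = k → L.card = k → ‖pairSum f K - pairSum f L‖ ≤ η)
    {p q : ι} (hpq : p ≠ q) (h0 : f {p, q} = 0) :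
    ∃ g : ι → Circ, g p = 0 ∧ (∀ a, (k - 1) • g a = 0) ∧
      ∀ a b, a ≠ b → ‖f {a, b} - (g a + g b - g q)‖ ≤ 4 * η := by
  have hk1 : 0 < k - 1 := by omega
  have near : ∀ a b j : ι, a ≠ b → a ≠ j → b ≠ j →
      ∃ G : Circ, (k - 1) • G = 0 ∧ ‖f {a, j} - f {b, j} - G‖ ≤ 2 * η :=
    fun a b j hab haj hbj => exists_torsion_near hk1 (norm_nsmul_swap_le hk hι hη H hab haj hbj)
  -- The torsion point depends only on `a` and `b`: those found for two values of `j` differ by at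
  -- most `2η` from the tetrad and `2η` from each approximation, and `6η` is below the least nonzero
  -- torsion norm.
  have near' : ∀ a b : ι, ∃ G : Circ, (k - 1) • G = 0 ∧
      ∀ j, a ≠ b → a ≠ j → b ≠ j → ‖f {a, j} - f {b, j} - G‖ ≤ 2 * η := by
    intro a b
    by_cases hab : a = b
    · exact ⟨0, by simp, fun j h => absurd hab h⟩
    have h2 : ({a, b} : Finset ι).card = 2 := Finset.card_pair hab
    obtain ⟨j₀, hj₀⟩ : (({a, b} : Finset ι)ᶜ).Nonempty := by
      rw [← Finset.card_pos, Finset.card_compl, h2]; omega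
    simp only [Finset.mem_compl, Finset.mem_insert, Finset.mem_singleton, not_or] at hj₀
    obtain ⟨G, hG, hGn⟩ := near a b j₀ hab (Ne.symm hj₀.1) (Ne.symm hj₀.2)
    refine ⟨G, hG, fun j _ haj hbj => ?_⟩
    obtain ⟨G', hG', hGn'⟩ := near a b j hab haj hbj
    have ht := norm_tetrad_le hk hι hη H hab haj (Ne.symm hj₀.1) hbj (Ne.symm hj₀.2)
    have : G' - G = 0 := by
      refine eq_zero_of_torsion hk1 (by rw [smul_sub, hG, hG', sub_zero]) (lt_of_le_of_lt ?_ hηk)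
      have : G' - G = ((f {a, j} - f {b, j}) - (f {a, j₀} - f {b, j₀}))
          - (f {a, j} - f {b, j} - G') + (f {a, j₀} - f {b, j₀} - G) := by abel
      rw [this]
      refine (norm_add_le _ _).trans ?_
      have := norm_sub_le ((f {a, j} - f {b, j}) - (f {a, j₀} - f {b, j₀}))
        (f {a, j} - f {b, j} - G')
      linarith
    rw [← sub_eq_zero.1 this]
    exact hGn'
  choose G hG hGn using near'
  -- Again three errors of `2η`, now with one auxiliary point `j`, force an exact identity between
  -- torsion points.
  have cocycle : ∀ a, a ≠ p → a ≠ q → G a q = G a p - G q p := by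
    intro a hap haq
    have h3 : ({a, p, q} : Finset ι).card = 3 := by
      simp [Finset.card_insert_of_notMem, hap, haq, hpq]
    obtain ⟨j, hj⟩ : (({a, p, q} : Finset ι)ᶜ).Nonempty := by
      rw [← Finset.card_pos, Finset.card_compl, h3]; omega
    simp only [Finset.mem_compl, Finset.mem_insert, Finset.mem_singleton, not_or] at hj
    obtain ⟨hja, hjp, hjq⟩ := hj
    rw [← sub_eq_zero]
    refine eq_zero_of_torsion hk1 (by simp only [smul_sub, hG, sub_zero]) (lt_of_le_of_lt ?_ hηk)
    have : G a q - (G a p - G q p) = (f {a, j} - f {p, j} - G a p) - (f {q, j} - f {p, j} - G q p)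
      - (f {a, j} - f {q, j} - G a q) := by abel
    rw [this]
    refine (norm_sub_le _ _).trans ?_
    have h1 := norm_sub_le (f {a, j} - f {p, j} - G a p) (f {q, j} - f {p, j} - G q p)
    have h2 := hGn a p j hap (Ne.symm hja) (Ne.symm hjp)
    have h3 := hGn q p j hpq.symm (Ne.symm hjq) (Ne.symm hjp)
    have h4 := hGn a q j haq (Ne.symm hja) (Ne.symm hjq)
    linarith
  -- Differences with `p` define `g`; the normalization `f {p, q} = 0` then fixes the constant `-g
  -- q`.
  let g : ι → Circ := fun a => if a = p then 0 else G a p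
  have hgp : g p = 0 := by simp [g]
  have hg : ∀ a, a ≠ p → g a = G a p := fun a ha => by simp [g, ha]
  have toP : ∀ b, b ≠ p → ‖f {b, p} - (g b - g q)‖ ≤ 2 * η := by
    intro b hb
    by_cases hbq : b = q
    · subst hbq
      rw [Finset.pair_comm, h0]
      simpa using hη
    · have h := hGn b q p hbq hb hpq.symm
      rw [cocycle b hb hbq, Finset.pair_comm q p, h0, sub_zero] at h
      rw [hg b hb, hg q hpq.symm]
      exact h
  refine ⟨g, hgp, fun a => ?_, fun a b hab => ?_⟩
  · by_cases ha : a = p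
    · rw [ha, hgp, smul_zero]
    · rw [hg a ha, hG]
  · by_cases ha : a = p
    · subst ha
      rw [hgp, zero_add, Finset.pair_comm]
      have := toP b (Ne.symm hab)
      linarith
    by_cases hb : b = p
    · subst hb
      rw [hgp, add_zero]
      have := toP a ha
      linarith
    · have h1 := hGn a p b ha hab (Ne.symm hb)
      rw [← hg a ha] at h1
      have h2 := toP b hb
      have : f {a, b} - (g a + g b - g q) =
          (f {a, b} - f {p, b} - g a) + (f {p, b} - (g b - g q)) := by abel
      rw [this]
      rw [Finset.pair_comm b p] at h2
      refine (norm_add_le _ _).trans ?_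
      linarith

/-! ### Restoring the deleted coordinate with value zero -/

section Ext

variable {v : ℕ} {A : Type*}

/-- The extension by zero of a function on `Pair' v` to all finite subsets. -/
def ext [Zero A] (θ : Pair' v → A) (S : Finset (Fin v)) : A :=
  if h : S.card = 2 ∧ S ≠ lastPair v then θ ⟨⟨S, h.1⟩, h.2⟩ else 0

theorem ext_coe [Zero A] (θ : Pair' v → A) (S : Pair' v) : ext θ S.1.1 = θ S := by
  unfold ext
  rw [dif_pos ⟨S.1.2, S.2⟩]

theorem ext_lastPair [Zero A] (θ : Pair' v → A) : ext θ (lastPair v) = 0 := by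
  simp [ext]

theorem ext_add [AddZeroClass A] (θ η : Pair' v → A) (S : Finset (Fin v)) :
    ext (θ + η) S = ext θ S + ext η S := by
  unfold ext
  split_ifs <;> simp

theorem pairSum_ext_add [AddCommMonoid A] (θ η : Pair' v → A) (K : Finset (Fin v)) :
    pairSum (ext (θ + η)) K = pairSum (ext θ) K + pairSum (ext η) K := by
  simp [pairSum, ext_add, Finset.sum_add_distrib]

theorem pairSum_ext_map {B : Type*} [AddCommMonoid A] [AddCommMonoid B] (φ : A →+ B)
    (θ : Pair' v → A) (K : Finset (Fin v)) :
    pairSum (ext fun S => φ (θ S)) K = φ (pairSum (ext θ) K) := by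
  simp only [pairSum, map_sum]
  refine Finset.sum_congr rfl fun S _ => ?_
  unfold ext
  split_ifs <;> simp

theorem pairSum_ext_eq [AddCommMonoid A] (θ : Pair' v → A) (K : Finset (Fin v)) :
    pairSum (ext θ) K = ∑ S : Pair' v, if S.1.1 ⊆ K then θ S else 0 := by
  rw [← Finset.sum_filter]
  symm
  unfold pairSum
  refine Finset.sum_of_injOn (fun S : Pair' v => S.1.1) ?_ ?_ ?_ ?_
  · intro S _ T _ h
    exact Subtype.ext (Subtype.ext h)
  · intro S hS
    have hS' := (Finset.mem_filter.1 hS).2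
    exact Finset.mem_coe.2 (Finset.mem_powersetCard.2 ⟨hS', S.1.2⟩)
  · intro S hS hS'
    obtain ⟨h1, h2⟩ := Finset.mem_powersetCard.1 hS
    by_cases hl : S = lastPair v
    · rw [hl, ext_lastPair]
    · exact absurd ⟨⟨⟨S, h2⟩, hl⟩, by simpa using h1, rfl⟩ hS'
  · intro S _
    exact (ext_coe θ S).symm

end Ext

/-! ### The centers of the major arcs -/

section Centers

variable {v k : ℕ} {p q : Fin v}

/-- The function `S ↦ ∑_{a ∈ S} g a - g q` on pairs. -/
def centerFun {ι A : Type*} [AddCommGroup A] (g : ι → A) (q : ι) (S : Finset ι) : A :=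
  ∑ a ∈ S, g a - g q

/-- Each point of `K` lies in `K.card - 1` pairs. The terms are moved across so that no
natural-number subtraction occurs. -/
theorem pairSum_centerFun {ι A : Type*} [DecidableEq ι] [AddCommGroup A] (g : ι → A) (q : ι)
    (K : Finset ι) :
    pairSum (centerFun g q) K + ∑ a ∈ K, g a + K.card.choose 2 • g q = K.card • ∑ a ∈ K, g a := by
  induction K using Finset.induction_on with
  | empty =>
    have : Finset.powersetCard 2 (∅ : Finset ι) = ∅ := Finset.powersetCard_eq_empty.2 (by simp)
    simp [pairSum, this]
  | insert a K ha ih =>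
    have h : ∑ i ∈ K, centerFun g q {a, i} = K.card • g a + ∑ i ∈ K, g i - K.card • g q := by
      have : ∀ i ∈ K, centerFun g q {a, i} = g a + g i - g q := by
        intro i hi
        have hai : a ≠ i := fun h => ha (h ▸ hi)
        rw [centerFun, Finset.sum_pair hai]
      rw [Finset.sum_congr rfl this, Finset.sum_sub_distrib, Finset.sum_add_distrib,
        Finset.sum_const, Finset.sum_const]
    rw [pairSum_insert _ ha, h, Finset.sum_insert ha, Finset.card_insert_of_notMem ha,
      Nat.choose_succ_succ' K.card 1, Nat.choose_one_right, add_smul, add_smul, one_smul, smul_add,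
      ← ih]
    abel

theorem ext_centerFun {A : Type*} [AddCommGroup A] {g : Fin v → A} (hl : lastPair v = {p, q})
    (hpq : p ≠ q) (hg : g p = 0) {S : Finset (Fin v)} (hS : S.card = 2) :
    ext (fun T : Pair' v => centerFun g q T.1.1) S = centerFun g q S := by
  unfold ext
  split_ifs with h
  · rfl
  · have : S = {p, q} := by
      by_contra hne
      exact h ⟨hS, hl ▸ hne⟩
    rw [this, centerFun, Finset.sum_pair hpq, hg]
    simp

theorem pairSum_ext_centerFun {A : Type*} [AddCommGroup A] {g : Fin v → A}
    (hl : lastPair v = {p, q}) (hpq : p ≠ q) (hg : g p = 0) (K : Finset (Fin v)) :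
    pairSum (ext fun T : Pair' v => centerFun g q T.1.1) K = pairSum (centerFun g q) K :=
  Finset.sum_congr rfl fun _ hS => ext_centerFun hl hpq hg (Finset.mem_powersetCard.1 hS).2

/-- The torsion point `2πm/n`. -/
noncomputable def torsionPt (n m : ℕ) : Circ := (((m : ℝ) / n * (2 * Real.pi) : ℝ) : Circ)

theorem nsmul_torsionPt {n : ℕ} (hn : 0 < n) {m : ℕ} (hm : m < n) : n • torsionPt n m = 0 :=
  (AddCircle.nsmul_eq_zero_iff hn).2 ⟨m, hm, rfl⟩

theorem torsionPt_injective {n m m' : ℕ} (hm : m < n) (hm' : m' < n)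
    (h : torsionPt n m = torsionPt n m') : m = m' := by
  have hn : (0 : ℝ) < n := by exact_mod_cast (lt_of_le_of_lt (Nat.zero_le _) hm)
  unfold torsionPt at h
  rw [← sub_eq_zero, ← AddCircle.coe_sub, AddCircle.coe_eq_zero_iff] at h
  obtain ⟨z, hz⟩ := h
  rw [zsmul_eq_mul, ← sub_mul] at hz
  have h1 := mul_right_cancel₀ Real.two_pi_pos.ne' hz
  rw [← sub_div, eq_div_iff hn.ne'] at h1
  have h2 : z * n = (m : ℤ) - m' := by exact_mod_cast h1
  have h3 : (m : ℤ) < n := by exact_mod_cast hm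
  have h4 : (m' : ℤ) < n := by exact_mod_cast hm'
  have : z = 0 := by
    by_contra hz0
    rcases lt_or_gt_of_ne hz0 with h | h
    · nlinarith
    · nlinarith
  subst this
  omega

/-- The index set of the centers. -/
abbrev CenterIndex (k : ℕ) (p : Fin v) : Type := {a : Fin v // a ≠ p} → Fin (k - 1)

/-- The torsion function of an index. -/
noncomputable def torsionFun (m : CenterIndex k p) (a : Fin v) : Circ :=
  if h : a ≠ p then torsionPt (k - 1) (m ⟨a, h⟩) else 0

theorem torsionFun_self (m : CenterIndex k p) : torsionFun m p = 0 := by simp [torsionFun]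

theorem nsmul_torsionFun (hk : 2 ≤ k) (m : CenterIndex k p) (a : Fin v) :
    (k - 1) • torsionFun m a = 0 := by
  unfold torsionFun
  split_ifs
  · exact nsmul_torsionPt (by omega) (m _).2
  · simp

/-- The points of the torus at which the characteristic function has absolute value one. -/
noncomputable def center (q : Fin v) (m : CenterIndex k p) : Pair' v → Circ :=
  fun S => centerFun (torsionFun m) q S.1.1

theorem card_centerIndex : Fintype.card (CenterIndex k p) = (k - 1) ^ (v - 1) := by
  rw [Fintype.card_fun, Fintype.card_fin, Fintype.card_subtype_compl, Fintype.card_fin,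
    Fintype.card_unique]

/-- Differences of centers are `(k-1)`-torsion in each coordinate, so they vanish or have norm at
least `2π/(k-1)`. A center determines its torsion function: the pair `{a, q}` gives the value at
`a`, and then `{a, p}` gives the value at `q`. -/
theorem center_separated (hk : 2 ≤ k) (hv : 3 ≤ v) (hl : lastPair v = {p, q}) (hpq : p ≠ q)
    {m m' : CenterIndex k p} (hm : m ≠ m') :
    ∃ S, 2 * Real.pi / (k - 1 : ℕ) ≤ ‖center q m S - center q m' S‖ := by
  by_contra! hc
  apply hm
  have hk1 : 0 < k - 1 := by omega
  have tors : ∀ (m : CenterIndex k p) S, (k - 1) • center q m S = 0 := by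
    intro m S
    simp [center, centerFun, smul_sub, Finset.smul_sum, nsmul_torsionFun hk]
  have heq : ∀ S, center q m S = center q m' S := fun S =>
    sub_eq_zero.1 (eq_zero_of_torsion hk1 (by rw [smul_sub, tors, tors, sub_zero]) (hc S))
  have heq' : ∀ a b : Fin v, a ≠ b → a ≠ p → a ≠ q →
      torsionFun m a + torsionFun m b - torsionFun m q =
        torsionFun m' a + torsionFun m' b - torsionFun m' q := by
    intro a b hab hap haq
    have hne : ({a, b} : Finset (Fin v)) ≠ lastPair v := by
      rw [hl]
      intro h
      have : a ∈ ({p, q} : Finset (Fin v)) := by rw [← h]; simp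
      simp [hap, haq] at this
    have := heq ⟨⟨{a, b}, Finset.card_pair hab⟩, hne⟩
    simpa [center, centerFun, Finset.sum_pair hab] using this
  have h1 : ∀ a : Fin v, a ≠ p → a ≠ q → torsionFun m a = torsionFun m' a := by
    intro a hap haq
    simpa using heq' a q haq hap haq
  have h2 : torsionFun m q = torsionFun m' q := by
    have hc2 : ({p, q} : Finset (Fin v)).card = 2 := Finset.card_pair hpq
    obtain ⟨a, ha⟩ : (({p, q} : Finset (Fin v))ᶜ).Nonempty := by
      rw [← Finset.card_pos, Finset.card_compl, hc2, Fintype.card_fin]; omega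
    simp only [Finset.mem_compl, Finset.mem_insert, Finset.mem_singleton, not_or] at ha
    have := heq' a p ha.1 ha.1 ha.2
    rw [torsionFun_self, torsionFun_self, h1 a ha.1 ha.2] at this
    simpa using this
  funext ⟨a, ha⟩
  have h3 : torsionFun m a = torsionFun m' a := by
    by_cases haq : a = q
    · rw [haq, h2]
    · exact h1 a ha haq
  simp only [torsionFun, dif_pos ha] at h3
  exact Fin.ext (torsionPt_injective (m _).2 (m' _).2 h3)

theorem exists_center (hk : 2 ≤ k) (hvk : k + 2 ≤ v) (hl : lastPair v = {p, q}) (hpq : p ≠ q)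
    {η : ℝ} (hη : 0 ≤ η) (hηk : 6 * η < 2 * Real.pi / (k - 1 : ℕ)) {θ : Pair' v → Circ}
    (H : ∀ K L : Finset (Fin v), K.card = k → L.card = k →
      ‖pairSum (ext θ) K - pairSum (ext θ) L‖ ≤ η) :
    ∃ m : CenterIndex k p, ∀ S, ‖θ S - center q m S‖ ≤ 4 * η := by
  obtain ⟨g, hgp, hg, hgn⟩ := exists_center_near hk (by simpa using hvk) hη hηk H hpq
    (by rw [← hl, ext_lastPair])
  have hk1 : 0 < k - 1 := by omega
  have : ∀ a : Fin v, ∃ m : Fin (k - 1), torsionPt (k - 1) m = g a := by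
    intro a
    obtain ⟨m, hm, h⟩ := (AddCircle.nsmul_eq_zero_iff hk1).1 (hg a)
    exact ⟨⟨m, hm⟩, h⟩
  choose m hm using this
  refine ⟨fun a => m a.1, fun S => ?_⟩
  have hgt : torsionFun (p := p) (fun a => m a.1) = g := by
    funext a
    unfold torsionFun
    split_ifs with h
    · exact hm a
    · push Not at h
      rw [h, hgp]
  obtain ⟨a, b, hab, hS⟩ := Finset.card_eq_two.1 S.1.2
  have h := hgn a b hab
  rw [← hS, ext_coe] at h
  rw [center, hgt, centerFun, hS, Finset.sum_pair hab]
  exact h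

/-- Each point of a `k`-set lies in `k - 1` of its pairs, so torsion removes all but the constant;
the value is the same for every `k`-set. -/
theorem pairSum_center (hk : 2 ≤ k) (hl : lastPair v = {p, q}) (hpq : p ≠ q)
    (m : CenterIndex k p) {K : Finset (Fin v)} (hK : K.card = k) :
    pairSum (ext (center q m)) K = -(k.choose 2 • torsionFun m q) := by
  have h := pairSum_centerFun (torsionFun m) q K
  have h0 : K.card • ∑ a ∈ K, torsionFun m a = ∑ a ∈ K, torsionFun m a := by
    have hk' : K.card = (k - 1) + 1 := by omega
    rw [hk', add_smul, one_smul, Finset.smul_sum]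
    simp [nsmul_torsionFun hk]
  rw [h0, hK] at h
  unfold center
  rw [pairSum_ext_centerFun hl hpq (torsionFun_self m), eq_neg_iff_add_eq_zero]
  rw [add_right_comm] at h
  simpa using h

theorem pairSum_center_univ (hv : 1 ≤ v) (hl : lastPair v = {p, q}) (hpq : p ≠ q)
    (m : CenterIndex k p) :
    pairSum (ext (center q m)) Finset.univ =
      (v - 1) • ∑ a, torsionFun m a - v.choose 2 • torsionFun m q := by
  have h := pairSum_centerFun (torsionFun m) q Finset.univ
  unfold center
  rw [pairSum_ext_centerFun hl hpq (torsionFun_self m), eq_sub_iff_add_eq]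
  have h0 : (Finset.univ : Finset (Fin v)).card • ∑ a, torsionFun m a =
      (v - 1) • ∑ a, torsionFun m a + ∑ a, torsionFun m a := by
    have : (Finset.univ : Finset (Fin v)).card = (v - 1) + 1 := by
      rw [Finset.card_univ, Fintype.card_fin]; omega
    rw [this, add_smul, one_smul]
  rw [h0, Finset.card_univ, Fintype.card_fin, add_right_comm] at h
  exact add_right_cancel h

end Centers

/-! ### Columns as `k`-sets and the characteristic function of a step -/

section CharacteristicFunction

variable {v k : ℕ} {p q : Fin v}

/-- The support of a column. -/
def supp (y : Column v k) : Finset (Fin v) := Finset.univ.filter fun i => y.1 i = 1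

theorem val_eq_ite (x : Fin 2) : (x : ℕ) = if x = 1 then 1 else 0 := by
  fin_cases x <;> simp

theorem card_supp (y : Column v k) : (supp y).card = k := by
  rw [supp, Finset.card_filter]
  conv_rhs => rw [← y.2]
  exact Finset.sum_congr rfl fun i _ => (val_eq_ite _).symm

/-- Columns correspond to `k`-subsets. -/
def columnEquiv (v k : ℕ) : Column v k ≃ {K : Finset (Fin v) // K.card = k} where
  toFun y := ⟨supp y, card_supp y⟩
  invFun K := ⟨fun i => if i ∈ K.1 then 1 else 0, by
    have : ∀ i : Fin v, (((if i ∈ K.1 then 1 else 0 : Fin 2)) : ℕ) = if i ∈ K.1 then 1 else 0 := by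
      intro i; split_ifs <;> simp
    simp only [this, Finset.sum_boole, Finset.filter_univ_mem]
    exact_mod_cast K.2⟩
  left_inv y := by
    apply Subtype.ext
    funext i
    simp only [supp, Finset.mem_filter, Finset.mem_univ, true_and]
    have h2 : ∀ x : Fin 2, (if x = 1 then 1 else 0) = x := by decide
    exact h2 _
  right_inv K := by
    apply Subtype.ext
    ext i
    simp [supp]

theorem card_column (v k : ℕ) : Fintype.card (Column v k) = v.choose k := by
  rw [Fintype.card_congr (columnEquiv v k), Fintype.card_finset_len, Fintype.card_fin]

theorem Z_eq_ite (y : Column v k) (S : Pair v) : Z y S = if S.1 ⊆ supp y then 1 else 0 := by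
  unfold Z
  have h : ∀ i, ((y.1 i : ℕ) : ℝ) = if i ∈ supp y then 1 else 0 := by
    intro i
    rw [val_eq_ite]
    simp [supp]
  simp only [h, Finset.prod_ite_zero, Finset.prod_const_one]
  exact if_congr Iff.rfl rfl rfl

/-- The character `u ↦ exp(iu)` of the circle. -/
noncomputable def circExp (u : Circ) : ℂ := (AddCircle.toCircle u : Circle)

theorem circExp_add (u w : Circ) : circExp (u + w) = circExp u * circExp w := by
  unfold circExp
  rw [AddCircle.toCircle_add, Circle.coe_mul]

theorem circExp_zero : circExp 0 = 1 := by simp [circExp]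

theorem circExp_mul_neg (u : Circ) : circExp u * circExp (-u) = 1 := by
  rw [← circExp_add, add_neg_cancel, circExp_zero]

theorem circExp_nsmul (u : Circ) (n : ℕ) : circExp (n • u) = circExp u ^ n := by
  unfold circExp
  rw [AddCircle.toCircle_nsmul, Circle.coe_pow]

theorem circExp_sum {ι : Type*} (s : Finset ι) (u : ι → Circ) :
    circExp (∑ i ∈ s, u i) = ∏ i ∈ s, circExp (u i) := by
  classical
  induction s using Finset.induction_on with
  | empty => simp [circExp_zero]
  | insert a s ha ih => rw [Finset.sum_insert ha, Finset.prod_insert ha, circExp_add, ih]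

theorem norm_circExp (u : Circ) : ‖circExp u‖ = 1 := Circle.norm_coe _

theorem continuous_circExp : Continuous circExp :=
  continuous_subtype_val.comp AddCircle.continuous_toCircle

theorem circExp_coe (x : ℝ) : circExp (x : Circ) = Complex.exp (x * Complex.I) := by
  unfold circExp
  rw [AddCircle.toCircle_apply_mk, Circle.coe_exp]
  congr 2
  rw [div_self Real.two_pi_pos.ne', one_mul]

theorem continuous_pairSum_ext (K : Finset (Fin v)) :
    Continuous fun θ : Pair' v → Circ => pairSum (ext θ) K := by
  have h : (fun θ : Pair' v → Circ => pairSum (ext θ) K) =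
      fun θ => ∑ S : Pair' v, if S.1.1 ⊆ K then θ S else 0 :=
    funext fun θ => pairSum_ext_eq θ K
  rw [h]
  apply continuous_finsetSum
  intro S _
  split_ifs
  · exact continuous_apply S
  · exact continuous_const

/-- The characteristic function of a step of the walk, on the torus. -/
noncomputable def stepChar (k : ℕ) (θ : Pair' v → Circ) : ℂ :=
  (v.choose k : ℂ)⁻¹ * ∑ y : Column v k, circExp (pairSum (ext θ) (supp y))

/-- The integrand of the inversion formula for the probability that all entries of `X_t` are `l`. -/
noncomputable def integrand (k t l : ℕ) (θ : Pair' v → Circ) : ℂ :=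
  stepChar k θ ^ t * circExp (-(l • pairSum (ext θ) Finset.univ))

theorem stepChar_center_add (hk : 2 ≤ k) (hl : lastPair v = {p, q}) (hpq : p ≠ q)
    (m : CenterIndex k p) (θ : Pair' v → Circ) :
    stepChar k (center q m + θ) = circExp (-(k.choose 2 • torsionFun m q)) * stepChar k θ := by
  unfold stepChar
  rw [mul_left_comm]
  congr 1
  rw [Finset.mul_sum]
  refine Finset.sum_congr rfl fun y _ => ?_
  rw [pairSum_ext_add (center q m) θ, pairSum_center hk hl hpq m (card_supp y), circExp_add]

/-- The shift multiplies `stepChar ^ t` by a phase that the inversion factor must cancel. Here `h1`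
makes the coefficient of `∑ a, torsionFun m a` a multiple of `k - 1`, so torsion kills it, and `h2`
matches the multiples of `torsionFun m q`. -/
theorem integrand_center_add (hk : 2 ≤ k) (hv : 1 ≤ v) (hl : lastPair v = {p, q}) (hpq : p ≠ q)
    {t l r : ℕ} (h1 : l * (v - 1) = r * (k - 1)) (h2 : l * v.choose 2 = t * k.choose 2)
    (m : CenterIndex k p) (θ : Pair' v → Circ) :
    integrand k t l (center q m + θ) = integrand k t l θ := by
  unfold integrand
  rw [stepChar_center_add hk hl hpq, mul_pow, ← circExp_nsmul, pairSum_ext_add (center q m) θ,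
    pairSum_center_univ hv hl hpq, smul_add, neg_add, circExp_add]
  have h : (t • -(k.choose 2 • torsionFun m q)) =
      l • ((v - 1) • ∑ a, torsionFun m a - v.choose 2 • torsionFun m q) := by
    rw [smul_sub, smul_smul, smul_smul, h1, h2, mul_smul r, Finset.smul_sum, smul_neg, smul_smul]
    simp [nsmul_torsionFun hk]
  rw [h]
  have hinv := circExp_mul_neg
    (l • ((v - 1) • ∑ a, torsionFun m a - v.choose 2 • torsionFun m q))
  linear_combination (stepChar k θ ^ t * circExp (-(l • pairSum (ext θ) Finset.univ))) * hinv

theorem norm_integrand (t l : ℕ) (θ : Pair' v → Circ) :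
    ‖integrand k t l θ‖ = ‖stepChar k θ‖ ^ t := by
  rw [integrand, norm_mul, norm_circExp, mul_one, norm_pow]

theorem continuous_stepChar : Continuous (stepChar k : (Pair' v → Circ) → ℂ) :=
  continuous_const.mul <| continuous_finsetSum _ fun y _ =>
    continuous_circExp.comp (continuous_pairSum_ext (supp y))

theorem continuous_integrand (t l : ℕ) :
    Continuous (integrand k t l : (Pair' v → Circ) → ℂ) :=
  (continuous_stepChar.pow t).mul <|
    continuous_circExp.comp ((continuous_pairSum_ext Finset.univ).const_smul l).neg

end CharacteristicFunction

/-! ### Fourier inversion on the torus -/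

theorem integral_circExp_zsmul (n : ℤ) :
    ∫ u : Circ, circExp (n • u) = if n = 0 then ((2 * Real.pi : ℝ) : ℂ) else 0 := by
  split_ifs with h
  · subst h
    simp only [zero_smul, circExp_zero, integral_const]
    rw [measureReal_def, AddCircle.measure_univ, ENNReal.toReal_ofReal Real.two_pi_pos.le]
    simp
  · have hn : (n : ℝ) ≠ 0 := by exact_mod_cast h
    -- Translation by `π / n` changes the sign of the integrand but not the integral.
    have h1 : ∀ u : Circ, circExp (n • (u + ((Real.pi / n : ℝ) : Circ))) = -circExp (n • u) := by
      intro u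
      rw [smul_add, circExp_add, ← AddCircle.coe_zsmul, circExp_coe, zsmul_eq_mul,
        mul_div_cancel₀ _ hn, Complex.exp_pi_mul_I]
      ring
    have h2 := integral_add_right_eq_self (μ := (volume : Measure Circ))
      (fun u : Circ => circExp (n • u)) ((Real.pi / n : ℝ) : Circ)
    simp only [h1, integral_neg] at h2
    exact self_eq_neg.1 h2.symm

section Inversion

variable {v k t : ℕ}

theorem measureReal_finite_law {ι α : Type*} [Fintype ι] [DecidableEq ι] [Fintype α] [Nonempty α]
    [MeasurableSpace α] [MeasurableSingletonClass α] (B : Set (ι → α)) [DecidablePred (· ∈ B)] :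
    (Measure.pi fun _ : ι => uniformOn (Set.univ : Set α)).real B =
      ∑ x : ι → α, if x ∈ B then ((Fintype.card α : ℝ)⁻¹) ^ Fintype.card ι else 0 := by
  have hp : IsProbabilityMeasure (uniformOn (Set.univ : Set α)) :=
    isProbabilityMeasure_uniformOn Set.finite_univ Set.univ_nonempty
  have h1 : ∀ x : ι → α, (Measure.pi fun _ : ι => uniformOn (Set.univ : Set α)).real {x} =
      ((Fintype.card α : ℝ)⁻¹) ^ Fintype.card ι := by
    intro x
    rw [measureReal_def, Measure.pi_singleton]
    simp [uniformOn_univ]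
  rw [← Finset.sum_filter, ← Finset.sum_congr rfl fun x _ => h1 x]
  rw [sum_measureReal_singleton]
  simp

theorem sum_Z_eq (y : Column v k) : ∑ S : Pair v, Z y S = (k.choose 2 : ℝ) := by
  simp only [Z_eq_ite]
  have hc : k.choose 2 = ((supp y).powersetCard 2).card := by
    rw [Finset.card_powersetCard, card_supp]
  rw [Finset.sum_boole, hc]
  congr 1
  refine Finset.card_bij (fun S _ => S.1) ?_ ?_ ?_
  · intro S hS
    exact Finset.mem_powersetCard.2 ⟨(Finset.mem_filter.1 hS).2, S.2⟩
  · intro S _ T _ h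
    exact Subtype.ext h
  · intro S hS
    obtain ⟨h1, h2⟩ := Finset.mem_powersetCard.1 hS
    exact ⟨⟨S, h2⟩, by simpa using h1, rfl⟩

theorem card_pair (v : ℕ) : Fintype.card (Pair v) = dim v := by
  rw [Fintype.card_finset_len, Fintype.card_fin, dim]

variable {p q : Fin v}

theorem card_pair' (hl : lastPair v = {p, q}) (hpq : p ≠ q) :
    Fintype.card (Pair' v) = dim v - 1 := by
  have h2 : (lastPair v).card = 2 := by rw [hl, Finset.card_pair hpq]
  rw [← card_pair, Fintype.card_subtype_compl]
  congr 1
  rw [Fintype.card_eq_one_iff]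
  exact ⟨⟨⟨lastPair v, h2⟩, rfl⟩, fun S => Subtype.ext (Subtype.ext S.2)⟩

theorem sum_pair_eq (hl : lastPair v = {p, q}) (hpq : p ≠ q) (f : Pair v → ℝ) :
    ∑ S : Pair v, f S = ∑ S : Pair' v, f S.1 +
      f ⟨lastPair v, by rw [hl, Finset.card_pair hpq]⟩ := by
  rw [← Fintype.sum_subtype_add_sum_subtype (fun S : Pair v => S.1 ≠ lastPair v) f]
  congr 1
  have h2 : (lastPair v).card = 2 := by rw [hl, Finset.card_pair hpq]
  rw [Fintype.sum_eq_single ⟨⟨lastPair v, h2⟩, not_not.2 rfl⟩]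
  intro S hS
  exact absurd (Subtype.ext (Subtype.ext (not_not.1 S.2))) hS

theorem ratio_mul_dim (hv : 2 ≤ v) :
    ((k : ℝ) * (k - 1)) / ((v : ℝ) * (v - 1)) * (v.choose 2 : ℝ) = (k.choose 2 : ℝ) := by
  rw [Nat.cast_choose_two, Nat.cast_choose_two]
  have : (2 : ℝ) ≤ v := by exact_mod_cast hv
  have h1 : (v : ℝ) ≠ 0 := by linarith
  have h2 : (v : ℝ) - 1 ≠ 0 := by linarith
  field_simp

/-- The coordinates of `Y_t` sum to zero, so the last one vanishes once the others do; hence `d - 1`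
Fourier variables suffice. -/
theorem Y_eq_zero_iff (hv : 2 ≤ v) (hl : lastPair v = {p, q}) (hpq : p ≠ q) {l : ℕ}
    (hlt : (t : ℝ) * (((k : ℝ) * (k - 1)) / ((v : ℝ) * (v - 1))) = l) (ω : ℕ → Column v k) :
    Y t ω = 0 ↔ ∀ S : Pair' v, ∑ s ∈ Finset.range t, Z (ω s) S.1 = l := by
  have hX : ∀ S, X t ω S = ∑ s ∈ Finset.range t, Z (ω s) S := fun S => Finset.sum_apply _ _ _
  have hY : ∀ S, Y t ω S = ∑ s ∈ Finset.range t, Z (ω s) S - l := by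
    intro S
    rw [Y, hX, mul_comm, hlt]
  constructor
  · intro h S
    have := congrFun h S.1
    rw [hY] at this
    exact sub_eq_zero.1 this
  · intro h
    have hsum : ∑ S : Pair v, Y t ω S = 0 := by
      simp only [hY]
      rw [Finset.sum_sub_distrib, Finset.sum_comm]
      simp only [sum_Z_eq]
      rw [Finset.sum_const, Finset.sum_const, Finset.card_range, Finset.card_univ, card_pair, dim,
        nsmul_eq_mul, nsmul_eq_mul, ← hlt, ← ratio_mul_dim hv]
      ring
    have h' : ∀ S : Pair' v, Y t ω S.1 = 0 := fun S => by rw [hY, h S, sub_self]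
    rw [sum_pair_eq hl hpq, Finset.sum_eq_zero fun S _ => h' S, zero_add] at hsum
    funext S
    by_cases hS : S.1 = lastPair v
    · have : S = ⟨lastPair v, by rw [hl, Finset.card_pair hpq]⟩ := Subtype.ext hS
      rw [this]
      exact hsum
    · exact h' ⟨S, hS⟩

theorem nonempty_column (hkv : k ≤ v) : Nonempty (Column v k) := by
  rw [← Fintype.card_pos_iff, card_column]
  exact Nat.choose_pos hkv

theorem measureReal_walk (hkv : k ≤ v) (B : Set (Finset.range t → Column v k))
    [DecidablePred (· ∈ B)] :
    (walkMeasure v k).real {ω | (Finset.range t).restrict ω ∈ B} =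
      ∑ x : Finset.range t → Column v k, if x ∈ B then ((v.choose k : ℝ)⁻¹) ^ t else 0 := by
  have := nonempty_column hkv
  have hp : IsProbabilityMeasure (uniformOn (Set.univ : Set (Column v k))) :=
    isProbabilityMeasure_uniformOn Set.finite_univ Set.univ_nonempty
  have h := measureReal_finite_law (ι := Finset.range t) (α := Column v k) B
  rw [card_column, Fintype.card_coe, Finset.card_range] at h
  rw [← h, ← Measure.infinitePi_map_restrict (I := Finset.range t)
    (fun _ : ℕ => uniformOn (Set.univ : Set (Column v k))), map_measureReal_apply]
  · rfl
  · fun_prop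
  · exact B.toFinite.measurableSet

/-- The integrand is a product of characters, one per coordinate; orthogonality leaves only the
sequences whose coordinates all equal `l`. -/
theorem integral_torus_indicator (x : Finset.range t → Column v k) (l : ℕ) :
    ∫ θ : Pair' v → Circ, circExp (∑ s, pairSum (ext θ) (supp (x s)) +
        -(l • pairSum (ext θ) Finset.univ)) =
      if ∀ S : Pair' v, ∑ s, Z (x s) S.1 = l
        then ((2 * Real.pi : ℝ) : ℂ) ^ Fintype.card (Pair' v) else 0 := by
  classical
  let n : Pair' v → ℤ := fun S => ∑ s, (if S.1.1 ⊆ supp (x s) then 1 else 0) - l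
  have h1 : ∀ θ : Pair' v → Circ, circExp (∑ s, pairSum (ext θ) (supp (x s)) +
        -(l • pairSum (ext θ) Finset.univ)) = ∏ S, circExp (n S • θ S) := by
    intro θ
    rw [← circExp_sum]
    congr 1
    simp only [pairSum_ext_eq, Finset.subset_univ, if_true]
    rw [Finset.sum_comm, ← sub_eq_add_neg, Finset.smul_sum, ← Finset.sum_sub_distrib]
    refine Finset.sum_congr rfl fun S _ => ?_
    rw [sub_smul, Finset.sum_smul, natCast_zsmul]
    congr 1
    refine Finset.sum_congr rfl fun s _ => ?_
    split_ifs <;> simp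
  simp only [h1]
  rw [integral_fintype_prod_volume_eq_prod (fun S (u : Circ) => circExp (n S • u))]
  simp only [integral_circExp_zsmul]
  have hn : ∀ S, n S = 0 ↔ ∑ s, Z (x s) S.1 = l := by
    intro S
    simp only [Z_eq_ite, n, sub_eq_zero]
    constructor
    · intro h
      exact_mod_cast congrArg (Int.cast : ℤ → ℝ) h
    · intro h
      exact_mod_cast h
  simp only [← hn]
  split_ifs with h
  · simp [h]
  · push Not at h
    obtain ⟨S, hS⟩ := h
    exact Finset.prod_eq_zero (Finset.mem_univ S) (if_neg hS)

theorem integrand_eq_sum (t l : ℕ) (θ : Pair' v → Circ) :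
    integrand k t l θ = ∑ x : Finset.range t → Column v k, ((v.choose k : ℂ)⁻¹) ^ t *
      circExp (∑ s, pairSum (ext θ) (supp (x s)) + -(l • pairSum (ext θ) Finset.univ)) := by
  classical
  unfold integrand stepChar
  rw [mul_pow, ← Finset.mul_sum, mul_assoc]
  congr 1
  simp only [circExp_add, circExp_sum]
  rw [← Finset.sum_mul]
  congr 1
  have := Finset.prod_univ_sum (ι := Finset.range t) (fun _ => (Finset.univ : Finset (Column v k)))
    (fun _ y => circExp (pairSum (ext θ) (supp y)))
  rw [Fintype.piFinset_univ, Finset.prod_const, Finset.card_univ, Fintype.card_coe,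
    Finset.card_range] at this
  exact this

theorem returnProb_eq_integral (hkv : k ≤ v) (hv : 2 ≤ v) (hl : lastPair v = {p, q}) (hpq : p ≠ q)
    {l : ℕ} (hlt : (t : ℝ) * (((k : ℝ) * (k - 1)) / ((v : ℝ) * (v - 1))) = l) :
    (returnProb v k t : ℂ) = (((2 * Real.pi : ℝ) : ℂ) ^ Fintype.card (Pair' v))⁻¹ *
      ∫ θ : Pair' v → Circ, integrand k t l θ := by
  classical
  have h1 : returnProb v k t = ∑ x : Finset.range t → Column v k,
      if ∀ S : Pair' v, ∑ s, Z (x s) S.1 = l then ((v.choose k : ℝ)⁻¹) ^ t else 0 := by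
    have := measureReal_walk (t := t) hkv
      {x : Finset.range t → Column v k | ∀ S : Pair' v, ∑ s, Z (x s) S.1 = l}
    simp only [Set.mem_ofPred_eq] at this
    rw [← this, returnProb]
    congr 1
    ext ω
    rw [Set.mem_ofPred_eq, Set.mem_ofPred_eq, Y_eq_zero_iff hv hl hpq hlt]
    refine forall_congr' fun S => ?_
    rw [← Finset.sum_coe_sort]
    rfl
  have hpi : ((2 * Real.pi : ℝ) : ℂ) ^ Fintype.card (Pair' v) ≠ 0 :=
    pow_ne_zero _ (by exact_mod_cast Real.two_pi_pos.ne')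
  have hint : ∀ x : Finset.range t → Column v k, Integrable (fun θ : Pair' v → Circ =>
      circExp (∑ s, pairSum (ext θ) (supp (x s)) + -(l • pairSum (ext θ) Finset.univ))) := by
    intro x
    refine Continuous.integrable_of_hasCompactSupport ?_ (HasCompactSupport.of_compactSpace _)
    exact continuous_circExp.comp ((continuous_finsetSum _ fun s _ =>
      continuous_pairSum_ext _).add ((continuous_pairSum_ext _).const_smul l).neg)
  simp only [integrand_eq_sum]
  rw [integral_finsetSum _ fun x _ => (hint x).const_mul _]
  simp only [integral_const_mul, integral_torus_indicator]
  rw [h1, Finset.mul_sum, Complex.ofReal_sum]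
  refine Finset.sum_congr rfl fun x _ => ?_
  split_ifs
  · rw [mul_left_comm, inv_mul_cancel₀ hpi]
    push_cast
    ring
  · simp

/-! ### Integrality obstructions -/

/-- The return probability vanishes unless `X_t` can have all its coordinates equal. -/
theorem returnProb_eq_zero_of_forall (h : ∀ ω : ℕ → Column v k, Y t ω ≠ 0) :
    returnProb v k t = 0 := by
  have : {ω : ℕ → Column v k | Y t ω = 0} = ∅ := Set.eq_empty_of_forall_notMem h
  rw [returnProb, this, measureReal_empty]

theorem exists_int_of_Y_eq_zero (hv : 2 ≤ v) {ω : ℕ → Column v k} (h : Y t ω = 0) :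
    ∃ m : ℤ, (t : ℝ) * (((k : ℝ) * (k - 1)) / ((v : ℝ) * (v - 1))) = m := by
  obtain ⟨S, -, hS⟩ := Finset.exists_subset_card_eq (s := (Finset.univ : Finset (Fin v))) (n := 2)
    (by simpa using hv)
  have h0 := congrFun h ⟨S, hS⟩
  have hX : X t ω ⟨S, hS⟩ = ∑ s ∈ Finset.range t, Z (ω s) ⟨S, hS⟩ := Finset.sum_apply _ _ _
  rw [Y, hX] at h0
  refine ⟨∑ s ∈ Finset.range t, if S ⊆ supp (ω s) then 1 else 0, ?_⟩
  simp only [Z_eq_ite] at h0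
  push_cast
  have h1 := sub_eq_zero.1 h0
  rw [h1, mul_comm]

theorem sum_Z_insert (y : Column v k) (i : Fin v) :
    ∑ j ∈ Finset.univ.erase i, (if ({i, j} : Finset (Fin v)) ⊆ supp y then (1 : ℝ) else 0) =
      ((k : ℝ) - 1) * if i ∈ supp y then 1 else 0 := by
  split_ifs with h
  · have : ∀ j, ({i, j} : Finset (Fin v)) ⊆ supp y ↔ j ∈ supp y := by
      intro j
      simp [Finset.insert_subset_iff, h]
    simp only [this]
    rw [Finset.sum_boole]
    have h2 : {x ∈ Finset.univ.erase i | x ∈ supp y} = (supp y).erase i := by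
      ext x; simp [and_comm]
    rw [h2, Finset.card_erase_of_mem h, card_supp, Nat.cast_pred, mul_one]
    rw [← card_supp y]
    exact Finset.card_pos.2 ⟨i, h⟩
  · have : ∀ j, ¬ ({i, j} : Finset (Fin v)) ⊆ supp y := by
      intro j hj
      exact h (hj (by simp))
    simp [this]

/-- Double counting of the pairs through one point `i`: a column containing `i` contains `k - 1` of
them, and each of the `v - 1` pairs is covered equally often. The integer is the number of columns
containing `i`. -/
theorem exists_int_of_Y_eq_zero' (hk : 2 ≤ k) (hv : 2 ≤ v) {ω : ℕ → Column v k}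
    (h : Y t ω = 0) : ∃ m : ℤ, (t : ℝ) * ((k : ℝ) / v) = m := by
  let i : Fin v := ⟨0, by omega⟩
  let c : ℝ := ((k : ℝ) * (k - 1)) / ((v : ℝ) * (v - 1)) * t
  have h0 : ∀ j ∈ Finset.univ.erase i,
      ∑ s ∈ Finset.range t, (if ({i, j} : Finset (Fin v)) ⊆ supp (ω s) then (1 : ℝ) else 0) = c := by
    intro j hj
    have hij : i ≠ j := (Finset.ne_of_mem_erase hj).symm
    have h0 := congrFun h ⟨{i, j}, Finset.card_pair hij⟩
    have hX : X t ω ⟨{i, j}, Finset.card_pair hij⟩ =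
      ∑ s ∈ Finset.range t, Z (ω s) ⟨{i, j}, Finset.card_pair hij⟩ := Finset.sum_apply _ _ _
    rw [Y, hX] at h0
    simp only [Z_eq_ite] at h0
    exact sub_eq_zero.1 h0
  have h1 := Finset.sum_congr rfl h0
  rw [Finset.sum_comm] at h1
  simp only [sum_Z_insert] at h1
  rw [← Finset.mul_sum, Finset.sum_const, Finset.card_erase_of_mem (Finset.mem_univ i),
    Finset.card_univ, Fintype.card_fin, nsmul_eq_mul, Nat.cast_pred (by omega)] at h1
  refine ⟨∑ s ∈ Finset.range t, if i ∈ supp (ω s) then 1 else 0, ?_⟩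
  push_cast
  have hk' : (2 : ℝ) ≤ k := by exact_mod_cast hk
  have hv' : (2 : ℝ) ≤ v := by exact_mod_cast hv
  have e1 : (k : ℝ) - 1 ≠ 0 := by linarith
  have e2 : (v : ℝ) - 1 ≠ 0 := by linarith
  have e3 : (v : ℝ) ≠ 0 := by linarith
  apply mul_left_cancel₀ e1
  rw [h1]
  simp only [c]
  field_simp

end Inversion

/-! ### Taylor bounds for a centered characteristic function -/

section LocalEstimates

theorem avg_le {ι : Type*} [Fintype ι] [Nonempty ι] {f : ι → ℝ} {c : ℝ} (h : ∀ i, f i ≤ c) :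
    (Fintype.card ι : ℝ)⁻¹ * ∑ i, f i ≤ c := by
  have hn : (0 : ℝ) < Fintype.card ι := by exact_mod_cast Fintype.card_pos
  have := Finset.sum_le_card_nsmul Finset.univ f c fun i _ => h i
  rw [Finset.card_univ, nsmul_eq_mul] at this
  rw [inv_mul_le_iff₀ hn]
  exact this

theorem le_avg {ι : Type*} [Fintype ι] [Nonempty ι] {f : ι → ℝ} {c : ℝ} (h : ∀ i, c ≤ f i) :
    c ≤ (Fintype.card ι : ℝ)⁻¹ * ∑ i, f i := by
  have := avg_le (f := fun i => -f i) (c := -c) fun i => neg_le_neg (h i)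
  rw [Finset.sum_neg_distrib, mul_neg] at this
  linarith

variable {ι : Type*} [Fintype ι] {W : ι → ℝ} {x : ℝ}

/-- The characteristic function at `1` of a real function under the uniform distribution. -/
noncomputable def avgExp (W : ι → ℝ) : ℂ :=
  (Fintype.card ι : ℂ)⁻¹ * ∑ i, Complex.exp (W i * Complex.I)

/-- The second moment of a real function under the uniform distribution. -/
noncomputable def avgSq (W : ι → ℝ) : ℝ := (Fintype.card ι : ℝ)⁻¹ * ∑ i, W i ^ 2

theorem avgExp_re (W : ι → ℝ) :
    (avgExp W).re = (Fintype.card ι : ℝ)⁻¹ * ∑ i, Real.cos (W i) := by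
  have : (Fintype.card ι : ℂ)⁻¹ = (((Fintype.card ι : ℝ)⁻¹ : ℝ) : ℂ) := by push_cast; rfl
  rw [avgExp, this, Complex.re_ofReal_mul, Complex.re_sum]
  simp only [Complex.exp_ofReal_mul_I_re]

theorem avgExp_im (W : ι → ℝ) :
    (avgExp W).im = (Fintype.card ι : ℝ)⁻¹ * ∑ i, Real.sin (W i) := by
  have : (Fintype.card ι : ℂ)⁻¹ = (((Fintype.card ι : ℝ)⁻¹ : ℝ) : ℂ) := by push_cast; rfl
  rw [avgExp, this, Complex.im_ofReal_mul, Complex.im_sum]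
  simp only [Complex.exp_ofReal_mul_I_im]

theorem avgSq_nonneg : 0 ≤ avgSq W :=
  mul_nonneg (by positivity) (Finset.sum_nonneg fun _ _ => sq_nonneg _)

variable [Nonempty ι]

theorem avgSq_le (hx : ∀ i, |W i| ≤ x) : avgSq W ≤ x ^ 2 :=
  avg_le fun i => sq_le_sq' (abs_le.1 (hx i)).1 (abs_le.1 (hx i)).2

theorem avg_one_sub : (Fintype.card ι : ℝ)⁻¹ * ∑ i, (1 - W i ^ 2 / 2) = 1 - avgSq W / 2 := by
  have hn : (Fintype.card ι : ℝ) ≠ 0 := by exact_mod_cast Fintype.card_ne_zero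
  rw [Finset.sum_sub_distrib, Finset.sum_const, Finset.card_univ, nsmul_eq_mul, mul_one, mul_sub,
    inv_mul_cancel₀ hn, avgSq, ← Finset.sum_div]
  ring

theorem le_avgExp_re : 1 - avgSq W / 2 ≤ (avgExp W).re := by
  rw [avgExp_re, ← avg_one_sub]
  gcongr with i
  exact Real.one_sub_sq_div_two_le_cos

theorem avgExp_re_le (hx : ∀ i, |W i| ≤ x) (hx1 : x ≤ 1) :
    (avgExp W).re ≤ 1 - avgSq W / 2 + 5 / 96 * x ^ 4 := by
  rw [avgExp_re, ← avg_one_sub, ← sub_le_iff_le_add', ← mul_sub, ← Finset.sum_sub_distrib]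
  refine avg_le fun i => ?_
  have h := (abs_le.1 (Real.cos_bound ((hx i).trans hx1))).2
  have h4 : |W i| ^ 4 ≤ x ^ 4 := by gcongr; exact hx i
  linarith

/-- The mean is zero, so `sin` may be replaced by `sin w - w`, which is cubic. -/
theorem abs_avgExp_im_le (h0 : ∑ i, W i = 0) (hx : ∀ i, |W i| ≤ x) (hx1 : x ≤ 1 / 10) :
    |(avgExp W).im| ≤ x ^ 3 / 5 := by
  have h1 : (avgExp W).im = (Fintype.card ι : ℝ)⁻¹ * ∑ i, (Real.sin (W i) - W i) := by
    rw [avgExp_im, Finset.sum_sub_distrib, h0, sub_zero]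
  have hi : ∀ i, |Real.sin (W i) - W i| ≤ x ^ 3 / 5 := by
    intro i
    have hx0 : 0 ≤ x := (abs_nonneg _).trans (hx i)
    have h := Real.sin_bound ((hx i).trans (hx1.trans (by norm_num)))
    have h5 : |W i| ^ 5 ≤ x ^ 5 := by gcongr; exact hx i
    have h3 : |W i ^ 3 / 6| ≤ x ^ 3 / 6 := by
      rw [abs_div, abs_pow, abs_of_pos (by norm_num : (0 : ℝ) < 6)]
      gcongr
      exact hx i
    have e : Real.sin (W i) - W i = (Real.sin (W i) - (W i - W i ^ 3 / 6)) - W i ^ 3 / 6 := by ring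
    rw [e]
    refine (abs_sub _ _).trans ?_
    have : x ^ 5 ≤ x ^ 3 * (1 / 10) ^ 2 := by
      have : x ^ 5 = x ^ 3 * x ^ 2 := by ring
      rw [this]; gcongr
    have : 0 ≤ x ^ 3 := by positivity
    linarith
  rw [h1, abs_le]
  exact ⟨le_avg fun i => (abs_le.1 (hi i)).1, avg_le fun i => (abs_le.1 (hi i)).2⟩

theorem norm_avgExp_le (h0 : ∑ i, W i = 0) (hx : ∀ i, |W i| ≤ x) (hx1 : x ≤ 1 / 10) :
    ‖avgExp W‖ ≤
      Real.sqrt (1 + 1 / 4 * x ^ 6) * (1 + 1 / 3 * x ^ 4) * Real.exp (-(avgSq W / 2)) := by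
  have hx0 : 0 ≤ x := (abs_nonneg _).trans (hx (Classical.arbitrary ι))
  have hs0 := avgSq_nonneg (W := W)
  have hs1 := avgSq_le hx
  have ha1 := le_avgExp_re (W := W)
  have ha2 := avgExp_re_le hx (hx1.trans (by norm_num))
  have hb := abs_avgExp_im_le h0 hx hx1
  set a := (avgExp W).re
  set b := (avgExp W).im
  set s := avgSq W / 2
  have hx2 : x ^ 2 ≤ 1 / 100 := by nlinarith
  have ha9 : 9 / 10 ≤ a := by simp only [s] at *; linarith
  have hexp : 1 - s ≤ Real.exp (-s) := by
    have := Real.add_one_le_exp (-s); linarith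
  -- The Taylor error `5/96 x⁴` fits into `1/3 x⁴ exp(-s)` because `exp(-s) ≥ 1/2`.
  have hbound : a ≤ (1 + 1 / 3 * x ^ 4) * Real.exp (-s) := by
    have h4 : 0 ≤ x ^ 4 := by positivity
    have : 1 / 2 ≤ Real.exp (-s) := by simp only [s] at *; linarith
    nlinarith
  have hn : ‖avgExp W‖ = Real.sqrt (a ^ 2 + b ^ 2) := by
    rw [Complex.norm_eq_sqrt_sq_add_sq]
  have hb2 : b ^ 2 ≤ (x ^ 3 / 5) ^ 2 := sq_le_sq' (abs_le.1 hb).1 (abs_le.1 hb).2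
  have h6 : 0 ≤ x ^ 6 := by positivity
  have hab : a ^ 2 + b ^ 2 ≤ (1 + 1 / 4 * x ^ 6) * a ^ 2 := by
    have : (9 / 10) ^ 2 ≤ a ^ 2 := by gcongr
    have : (x ^ 3 / 5) ^ 2 = x ^ 6 / 25 := by ring
    nlinarith
  calc ‖avgExp W‖ ≤ Real.sqrt ((1 + 1 / 4 * x ^ 6) * a ^ 2) := by
        rw [hn]; exact Real.sqrt_le_sqrt hab
    _ = Real.sqrt (1 + 1 / 4 * x ^ 6) * a := by
        rw [Real.sqrt_mul (by positivity), Real.sqrt_sq (by linarith)]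
    _ ≤ _ := by
        rw [mul_assoc]
        gcongr

/-- In polar form the real part of the power is `‖z‖ ^ t cos(t arg z)`. The modulus is nearly
Gaussian, and the argument is of order `x³`, so the phase stays bounded while `t x³ ≤ 2`. -/
theorem le_avgExp_pow_re (h0 : ∑ i, W i = 0) (hx : ∀ i, |W i| ≤ x) (hx1 : x ≤ 1 / 10) {t : ℕ}
    (htx : t * x ^ 3 ≤ 2) :
    (1 + (t : ℝ) ^ 2 * x ^ 6) ^ (-(1 / 2) : ℝ) * (1 - 1 / 3 * x ^ 4) ^ t *
      Real.exp (-(avgSq W / 2)) ^ t ≤ (avgExp W ^ t).re := by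
  have hx0 : 0 ≤ x := (abs_nonneg _).trans (hx (Classical.arbitrary ι))
  have hs0 := avgSq_nonneg (W := W)
  have hs1 := avgSq_le hx
  have ha1 := le_avgExp_re (W := W)
  have hb := abs_avgExp_im_le h0 hx hx1
  set s := avgSq W / 2 with hs
  have hx2 : x ^ 2 ≤ 1 / 100 := by nlinarith
  have hx4 : x ^ 4 ≤ 1 / 100 := by nlinarith [sq_nonneg x]
  have hnorm : (avgExp W).re ≤ ‖avgExp W‖ := Complex.re_le_norm _
  have hre : 99 / 100 ≤ (avgExp W).re := by linarith
  have hnpos : 0 < ‖avgExp W‖ := by linarith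
  -- Combines `exp(-s)(1 + s) ≤ 1` with `1 - s² ≥ 1 - x⁴/4`, which holds as `s ≤ x²/2`.
  have hlow : (1 - 1 / 3 * x ^ 4) * Real.exp (-s) ≤ ‖avgExp W‖ := by
    have h1 : Real.exp (-s) * (1 + s) ≤ 1 := by
      have := Real.add_one_le_exp s
      calc Real.exp (-s) * (1 + s) ≤ Real.exp (-s) * Real.exp s := by gcongr; linarith
        _ = 1 := by rw [← Real.exp_add]; simp
    have h2 : 1 - 1 / 3 * x ^ 4 ≤ (1 - s) * (1 + s) := by
      have : s ^ 2 ≤ (x ^ 2 / 2) ^ 2 := by gcongr; linarith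
      nlinarith [sq_nonneg (x ^ 2)]
    have hs' : s ≤ 1 / 200 := by linarith
    calc (1 - 1 / 3 * x ^ 4) * Real.exp (-s) ≤ ((1 - s) * (1 + s)) * Real.exp (-s) := by gcongr
      _ = (1 - s) * (Real.exp (-s) * (1 + s)) := by ring
      _ ≤ (1 - s) * 1 := by gcongr; linarith
      _ ≤ ‖avgExp W‖ := by linarith
  have harg : |(avgExp W).arg| ≤ 33 / 100 * x ^ 3 := by
    rw [Complex.arg_of_re_nonneg (by linarith)]
    set y := (avgExp W).im / ‖avgExp W‖ with hy
    have hy1 : |y| ≤ 1 := by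
      rw [hy, abs_div, abs_norm, div_le_one hnpos]
      exact Complex.abs_im_le_norm _
    have h2 : |y| ≤ 21 / 100 * x ^ 3 := by
      rw [hy, abs_div, abs_norm, div_le_iff₀ hnpos]
      have : 0 ≤ x ^ 3 := by positivity
      nlinarith
    have h3 : |Real.arcsin y| ≤ Real.pi / 2 * |y| := by
      have h4 : ∀ z : ℝ, 0 ≤ z → z ≤ 1 → Real.arcsin z ≤ Real.pi / 2 * z := by
        intro z hz hz1
        have := Real.mul_le_sin (Real.arcsin_nonneg.2 hz) (Real.arcsin_le_pi_div_two z)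
        rw [Real.sin_arcsin (by linarith) hz1] at this
        calc Real.arcsin z = Real.pi / 2 * (2 / Real.pi * Real.arcsin z) := by
              field_simp
          _ ≤ _ := by gcongr
      rcases le_total 0 y with hy0 | hy0
      · rw [abs_of_nonneg hy0, abs_of_nonneg (Real.arcsin_nonneg.2 hy0)]
        exact h4 y hy0 (le_of_abs_le hy1)
      · rw [abs_of_nonpos hy0, abs_of_nonpos (Real.arcsin_nonpos.2 hy0), ← Real.arcsin_neg]
        exact h4 (-y) (by linarith) (by rw [← abs_of_nonpos hy0]; exact hy1)
    have hpi : Real.pi < 3.142 := by linarith [Real.pi_lt_d4]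
    have : 0 ≤ x ^ 3 := by positivity
    calc |Real.arcsin y| ≤ Real.pi / 2 * |y| := h3
      _ ≤ 3.142 / 2 * (21 / 100 * x ^ 3) := by gcongr
      _ ≤ _ := by nlinarith
  set X := (t : ℝ) * x ^ 3 with hX
  have hX0 : 0 ≤ X := by positivity
  -- With `X ≤ 2` the parabola `1 - (0.33 X)²/2` is nonnegative and lies above `(1 + X²)^(-1/2)`, as
  -- squaring shows.
  have hcos : (1 + (t : ℝ) ^ 2 * x ^ 6) ^ (-(1 / 2) : ℝ) ≤
      Real.cos (t * (avgExp W).arg) := by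
    have e : (t : ℝ) ^ 2 * x ^ 6 = X ^ 2 := by rw [hX]; ring
    have h1 := Real.one_sub_sq_div_two_le_cos (x := t * (avgExp W).arg)
    have h2 : |t * (avgExp W).arg| ≤ 33 / 100 * X := by
      rw [abs_mul, Nat.abs_cast, hX]
      calc (t : ℝ) * |(avgExp W).arg| ≤ t * (33 / 100 * x ^ 3) := by gcongr
        _ = _ := by ring
    have h3 : (t * (avgExp W).arg) ^ 2 ≤ (33 / 100 * X) ^ 2 :=
      sq_le_sq' (abs_le.1 h2).1 (abs_le.1 h2).2
    refine le_trans ?_ (show 1 - (33 / 100 * X) ^ 2 / 2 ≤ _ by linarith)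
    rw [e, Real.rpow_neg (by positivity), ← Real.sqrt_eq_rpow, inv_eq_one_div,
      div_le_iff₀ (by positivity)]
    have hX4 : X ^ 2 ≤ 4 := by nlinarith
    have hc0 : 0 ≤ 1 - (33 / 100 * X) ^ 2 / 2 := by nlinarith
    rw [← Real.sqrt_sq hc0, ← Real.sqrt_mul (sq_nonneg _)]
    apply Real.le_sqrt_of_sq_le
    nlinarith [sq_nonneg X, mul_nonneg (sq_nonneg X) (sub_nonneg.2 hX4),
      mul_nonneg (sq_nonneg X) (sq_nonneg (X ^ 2))]
  have hpow : (avgExp W ^ t).re = ‖avgExp W‖ ^ t * Real.cos (t * (avgExp W).arg) := by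
    conv_lhs => rw [← Complex.norm_mul_exp_arg_mul_I (avgExp W), mul_pow, ← Complex.exp_nat_mul]
    rw [← Complex.ofReal_pow, Complex.re_ofReal_mul]
    congr 1
    rw [← mul_assoc, ← Complex.ofReal_natCast, ← Complex.ofReal_mul, Complex.exp_ofReal_mul_I_re]
  rw [hpow, mul_assoc, ← mul_pow, mul_comm (‖avgExp W‖ ^ t)]
  have hnn : 0 ≤ (1 - 1 / 3 * x ^ 4) * Real.exp (-s) :=
    mul_nonneg (by linarith) (Real.exp_nonneg _)
  have : 0 ≤ (1 + (t : ℝ) ^ 2 * x ^ 6) ^ (-(1 / 2) : ℝ) := by positivity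
  gcongr
  exact this.trans hcos

end LocalEstimates

/-! ### Gaussian integrals over cubes and their linear images -/

section Gaussian

theorem integral_gaussian_disc {c R : ℝ} (hc : 0 < c) (hR : 0 ≤ R) :
    ∫ z : ℝ × ℝ, (if z.1 ^ 2 + z.2 ^ 2 ≤ R ^ 2 then Real.exp (-c * (z.1 ^ 2 + z.2 ^ 2)) else 0) =
      Real.pi / c * (1 - Real.exp (-c * R ^ 2)) := by
  rw [← integral_comp_polarCoord_symm]
  have h1 : ∀ z ∈ polarCoord.target, z.1 • (if (polarCoord.symm z).1 ^ 2 + (polarCoord.symm z).2 ^ 2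
      ≤ R ^ 2 then Real.exp (-c * ((polarCoord.symm z).1 ^ 2 + (polarCoord.symm z).2 ^ 2)) else 0) =
      ((Set.Iic R).indicator (fun r => r * Real.exp (-c * r ^ 2)) z.1) * 1 := by
    intro z hz
    have hz0 : 0 < z.1 := hz.1
    have e : (polarCoord.symm z).1 ^ 2 + (polarCoord.symm z).2 ^ 2 = z.1 ^ 2 := by
      rw [polarCoord_symm_apply]
      simp only
      linear_combination z.1 ^ 2 * Real.sin_sq_add_cos_sq z.2
    rw [e, mul_one]
    by_cases h : z.1 ≤ R
    · rw [if_pos (by gcongr), Set.indicator_of_mem (Set.mem_Iic.2 h), smul_eq_mul]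
    · rw [if_neg (by intro h'; exact h (abs_le_of_sq_le_sq' h' hR).2), Set.indicator_of_notMem (mt Set.mem_Iic.1 h), smul_zero]
  rw [setIntegral_congr_fun polarCoord.open_target.measurableSet h1]
  rw [polarCoord_target, Measure.volume_eq_prod, setIntegral_prod_mul
    (fun r : ℝ => (Set.Iic R).indicator (fun r => r * Real.exp (-c * r ^ 2)) r) (fun _ : ℝ => (1 : ℝ))]
  have h2 : ∫ r in Set.Ioi (0 : ℝ), (Set.Iic R).indicator (fun r => r * Real.exp (-c * r ^ 2)) r =
      (1 - Real.exp (-c * R ^ 2)) / (2 * c) := by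
    rw [setIntegral_indicator measurableSet_Iic, Set.Ioi_inter_Iic,
      ← intervalIntegral.integral_of_le hR]
    have hd : ∀ r ∈ Set.uIcc 0 R, HasDerivAt (fun r => -Real.exp (-c * r ^ 2) / (2 * c))
        (r * Real.exp (-c * r ^ 2)) r := by
      intro r _
      have := (((hasDerivAt_pow 2 r).const_mul (-c)).exp.neg).div_const (2 * c)
      refine this.congr_deriv ?_
      field_simp
      simp [mul_comm]
    rw [intervalIntegral.integral_eq_sub_of_hasDerivAt hd
      (Continuous.intervalIntegrable (by fun_prop) _ _)]
    simp
    ring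
  rw [h2]
  simp [Real.pi_pos.le]
  field_simp
  ring

theorem integral_gaussian_square (c a : ℝ) :
    (∫ w in Set.Icc (-a) a, Real.exp (-c * w ^ 2)) ^ 2 =
      ∫ z : ℝ × ℝ, (if |z.1| ≤ a ∧ |z.2| ≤ a then Real.exp (-c * (z.1 ^ 2 + z.2 ^ 2)) else 0) := by
  rw [sq, ← setIntegral_prod_mul, ← integral_indicator (measurableSet_Icc.prod measurableSet_Icc)]
  rw [Measure.volume_eq_prod]
  refine integral_congr_ae (Filter.Eventually.of_forall fun z => ?_)
  simp only [Set.indicator, Set.mem_prod, Set.mem_Icc, ← abs_le]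
  split_ifs
  · rw [← Real.exp_add]; ring_nf
  · rfl

theorem integrable_gaussian_plane {c : ℝ} (hc : 0 < c) :
    Integrable fun z : ℝ × ℝ => Real.exp (-c * (z.1 ^ 2 + z.2 ^ 2)) := by
  have := (integrable_exp_neg_mul_sq hc).mul_prod (integrable_exp_neg_mul_sq hc)
  refine this.congr (Filter.Eventually.of_forall fun z => ?_)
  simp only [← Real.exp_add]
  ring_nf

theorem integrable_gaussian_square {c : ℝ} (hc : 0 < c) (a : ℝ) :
    Integrable fun z : ℝ × ℝ =>
      if |z.1| ≤ a ∧ |z.2| ≤ a then Real.exp (-c * (z.1 ^ 2 + z.2 ^ 2)) else 0 := by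
  have h := (integrable_gaussian_plane hc).indicator
    ((measurableSet_Icc (a := -a) (b := a)).prod (measurableSet_Icc (a := -a) (b := a)))
  refine h.congr (Filter.Eventually.of_forall fun z => ?_)
  simp only [Set.indicator, Set.mem_prod, Set.mem_Icc, ← abs_le]

/-- The square `[-a, a]²` contains the disc of radius `a`, where polar coordinates give the exact
integral. -/
theorem gaussian_square_lower {c a : ℝ} (hc : 0 < c) (ha : 0 ≤ a) :
    Real.pi / c * (1 - Real.exp (-c * a ^ 2)) ≤
      (∫ w in Set.Icc (-a) a, Real.exp (-c * w ^ 2)) ^ 2 := by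
  rw [integral_gaussian_square, ← integral_gaussian_disc hc ha]
  have hm1 : MeasurableSet {z : ℝ × ℝ | z.1 ^ 2 + z.2 ^ 2 ≤ a ^ 2} :=
    (isClosed_le (by fun_prop) (by fun_prop)).measurableSet
  refine integral_mono ((integrable_gaussian_plane hc).indicator hm1)
    (integrable_gaussian_square hc a) fun z => ?_
  have he := Real.exp_nonneg (-c * (z.1 ^ 2 + z.2 ^ 2))
  simp only
  by_cases h : z.1 ^ 2 + z.2 ^ 2 ≤ a ^ 2
  · rw [if_pos h, if_pos]
    exact ⟨abs_le_of_sq_le_sq (by nlinarith [sq_nonneg z.2]) ha,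
      abs_le_of_sq_le_sq (by nlinarith [sq_nonneg z.1]) ha⟩
  · rw [if_neg h]
    split_ifs
    · exact he
    · rfl

/-- The square lies in the disc of radius `2a`; radius `√2 a` would suffice, but `2a` gives the
shape of the factor `U`. -/
theorem gaussian_square_upper {c a : ℝ} (hc : 0 < c) (ha : 0 ≤ a) :
    (∫ w in Set.Icc (-a) a, Real.exp (-c * w ^ 2)) ^ 2 ≤
      Real.pi / c * (1 - Real.exp (-c * (2 * a) ^ 2)) := by
  rw [integral_gaussian_square, ← integral_gaussian_disc hc (by linarith : 0 ≤ 2 * a)]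
  have hm1 : MeasurableSet {z : ℝ × ℝ | z.1 ^ 2 + z.2 ^ 2 ≤ (2 * a) ^ 2} :=
    (isClosed_le (by fun_prop) (by fun_prop)).measurableSet
  refine integral_mono (integrable_gaussian_square hc a)
    ((integrable_gaussian_plane hc).indicator hm1) fun z => ?_
  have he := Real.exp_nonneg (-c * (z.1 ^ 2 + z.2 ^ 2))
  simp only
  by_cases h : |z.1| ≤ a ∧ |z.2| ≤ a
  · rw [if_pos h, if_pos]
    have h1 := sq_le_sq' (abs_le.1 h.1).1 (abs_le.1 h.1).2
    have h2 := sq_le_sq' (abs_le.1 h.2).1 (abs_le.1 h.2).2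
    nlinarith
  · rw [if_neg h]
    split_ifs
    · exact he
    · rfl

variable {ι : Type*}

theorem cube_eq_pi (a : ℝ) :
    {w : ι → ℝ | ∀ i, |w i| ≤ a} = Set.univ.pi fun _ => Set.Icc (-a) a := by
  ext w
  simp only [Set.mem_pi, Set.mem_univ, true_implies, Set.mem_Icc, Set.mem_ofPred_eq, abs_le]

theorem isCompact_cube (a : ℝ) : IsCompact {w : ι → ℝ | ∀ i, |w i| ≤ a} := by
  rw [cube_eq_pi]
  exact isCompact_univ_pi fun _ => isCompact_Icc

variable [Fintype ι]

theorem setIntegral_gaussian_box (c a : ℝ) :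
    ∫ w in {w : ι → ℝ | ∀ i, |w i| ≤ a}, Real.exp (-c * ∑ i, w i ^ 2) =
      (∫ w in Set.Icc (-a) a, Real.exp (-c * w ^ 2)) ^ Fintype.card ι := by
  rw [cube_eq_pi, volume_pi, Measure.restrict_pi_pi]
  simp only [Finset.mul_sum, Real.exp_sum]
  exact integral_fintype_prod_eq_pow (fun w : ℝ => Real.exp (-c * w ^ 2))

/-- The disc comparison bounds a square, so an `m`-th power, with `m` possibly odd, gets the real
exponent `m / 2`. -/
theorem gaussian_pow_lower {c a : ℝ} (hc : 0 < c) (ha : 0 ≤ a) (m : ℕ) :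
    (Real.pi / c) ^ ((m : ℝ) / 2) * (1 - Real.exp (-c * a ^ 2)) ^ ((m : ℝ) / 2) ≤
      (∫ w in Set.Icc (-a) a, Real.exp (-c * w ^ 2)) ^ m := by
  have h0 : 0 ≤ ∫ w in Set.Icc (-a) a, Real.exp (-c * w ^ 2) :=
    integral_nonneg fun _ => Real.exp_nonneg _
  have h1 : 0 ≤ 1 - Real.exp (-c * a ^ 2) := by
    have : Real.exp (-c * a ^ 2) ≤ 1 := Real.exp_le_one_iff.2 (by nlinarith [sq_nonneg a])
    linarith
  rw [← Real.mul_rpow (by positivity) h1, ← Real.rpow_natCast _ m]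
  have : (∫ w in Set.Icc (-a) a, Real.exp (-c * w ^ 2)) ^ (m : ℝ) =
      ((∫ w in Set.Icc (-a) a, Real.exp (-c * w ^ 2)) ^ 2) ^ ((m : ℝ) / 2) := by
    rw [← Real.rpow_natCast _ 2, ← Real.rpow_mul h0]
    congr 1
    push_cast
    ring
  rw [this]
  exact Real.rpow_le_rpow (mul_nonneg (by positivity) h1) (gaussian_square_lower hc ha)
    (by positivity)

theorem gaussian_pow_upper {c a : ℝ} (hc : 0 < c) (ha : 0 ≤ a) (m : ℕ) :
    (∫ w in Set.Icc (-a) a, Real.exp (-c * w ^ 2)) ^ m ≤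
      (Real.pi / c) ^ ((m : ℝ) / 2) * (1 - Real.exp (-c * (2 * a) ^ 2)) ^ ((m : ℝ) / 2) := by
  have h0 : 0 ≤ ∫ w in Set.Icc (-a) a, Real.exp (-c * w ^ 2) :=
    integral_nonneg fun _ => Real.exp_nonneg _
  have h1 : 0 ≤ 1 - Real.exp (-c * (2 * a) ^ 2) := by
    have : Real.exp (-c * (2 * a) ^ 2) ≤ 1 :=
      Real.exp_le_one_iff.2 (by nlinarith [sq_nonneg (2 * a)])
    linarith
  rw [← Real.mul_rpow (by positivity) h1, ← Real.rpow_natCast _ m]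
  have : (∫ w in Set.Icc (-a) a, Real.exp (-c * w ^ 2)) ^ (m : ℝ) =
      ((∫ w in Set.Icc (-a) a, Real.exp (-c * w ^ 2)) ^ 2) ^ ((m : ℝ) / 2) := by
    rw [← Real.rpow_natCast _ 2, ← Real.rpow_mul h0]
    congr 1
    push_cast
    ring
  rw [this]
  exact Real.rpow_le_rpow (sq_nonneg _) (gaussian_square_upper hc ha) (by positivity)

theorem sum_mulVec_sq {P M : Matrix ι ι ℝ} (hP : P.IsHermitian) (hPM : P * P = M) (x : ι → ℝ) :
    ∑ i, P.mulVec x i ^ 2 = x ⬝ᵥ M.mulVec x := by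
  have hT : P.transpose = P := by simpa [Matrix.IsHermitian] using hP
  rw [← hPM, ← Matrix.mulVec_mulVec, Matrix.dotProduct_mulVec, ← Matrix.mulVec_transpose, hT]
  simp [dotProduct, sq]

variable [DecidableEq ι]

theorem setIntegral_comp_mulVec {P : Matrix ι ι ℝ} (hP : 0 < P.det) {B : Set (ι → ℝ)}
    (hB : MeasurableSet B) (f : (ι → ℝ) → ℝ) :
    ∫ x in B, f (P.mulVec x) = P.det⁻¹ * ∫ w in P.mulVec '' B, f w := by
  have hinj : Function.Injective P.mulVec :=
    Matrix.mulVec_injective_iff_isUnit.2 ((Matrix.isUnit_iff_isUnit_det P).2 hP.ne'.isUnit)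
  have h := integral_image_eq_integral_abs_det_fderiv_smul (volume : Measure (ι → ℝ)) hB
    (f := P.mulVec) (f' := fun _ => LinearMap.toContinuousLinearMap (Matrix.toLin' P))
    (fun x _ => (LinearMap.toContinuousLinearMap (Matrix.toLin' P)).hasFDerivWithinAt)
    hinj.injOn f
  rw [h]
  simp only [ContinuousLinearMap.det, LinearMap.coe_toContinuousLinearMap, LinearMap.det_toLin',
    abs_of_pos hP, smul_eq_mul]
  rw [integral_const_mul, ← mul_assoc, inv_mul_cancel₀ hP.ne', one_mul]

section Transformed

variable {P M : Matrix ι ι ℝ} {δ a c : ℝ}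

/-- The substitution `w = Px` makes the quadratic form `∑ w i ^ 2`; the image of the box is then
shrunk to the inner cube. -/
theorem setIntegral_gaussian_lower (hP : P.PosDef) (hPM : P * P = M) (hc : 0 < c) (ha : 0 ≤ a)
    (h : {w : ι → ℝ | ∀ i, |w i| ≤ a} ⊆ P.mulVec '' {x : ι → ℝ | ∀ i, |x i| ≤ δ}) :
    P.det⁻¹ * ((Real.pi / c) ^ ((Fintype.card ι : ℝ) / 2) *
        (1 - Real.exp (-c * a ^ 2)) ^ ((Fintype.card ι : ℝ) / 2)) ≤
      ∫ x in {x : ι → ℝ | ∀ i, |x i| ≤ δ}, Real.exp (-c * (x ⬝ᵥ M.mulVec x)) := by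
  have hdet := hP.det_pos
  simp only [← sum_mulVec_sq hP.1 hPM]
  rw [setIntegral_comp_mulVec hdet (isCompact_cube δ).measurableSet
    (fun w => Real.exp (-c * ∑ i, w i ^ 2))]
  refine mul_le_mul_of_nonneg_left ?_ (inv_nonneg.2 hdet.le)
  refine (gaussian_pow_lower hc ha _).trans ?_
  rw [← setIntegral_gaussian_box]
  refine setIntegral_mono_set ?_ (Filter.Eventually.of_forall fun _ => Real.exp_nonneg _)
    h.eventuallyLE
  have hcont : Continuous P.mulVec := by fun_prop
  exact ContinuousOn.integrableOn_compact ((isCompact_cube δ).image hcont) (by fun_prop)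

theorem setIntegral_gaussian_upper (hP : P.PosDef) (hPM : P * P = M) (hc : 0 < c) (ha : 0 ≤ a)
    (h : P.mulVec '' {x : ι → ℝ | ∀ i, |x i| ≤ δ} ⊆ {w : ι → ℝ | ∀ i, |w i| ≤ a}) :
    ∫ x in {x : ι → ℝ | ∀ i, |x i| ≤ δ}, Real.exp (-c * (x ⬝ᵥ M.mulVec x)) ≤
      P.det⁻¹ * ((Real.pi / c) ^ ((Fintype.card ι : ℝ) / 2) *
        (1 - Real.exp (-c * (2 * a) ^ 2)) ^ ((Fintype.card ι : ℝ) / 2)) := by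
  have hdet := hP.det_pos
  simp only [← sum_mulVec_sq hP.1 hPM]
  rw [setIntegral_comp_mulVec hdet (isCompact_cube δ).measurableSet
    (fun w => Real.exp (-c * ∑ i, w i ^ 2))]
  refine mul_le_mul_of_nonneg_left ?_ (inv_nonneg.2 hdet.le)
  refine le_trans ?_ (gaussian_pow_upper hc ha _)
  rw [← setIntegral_gaussian_box]
  refine setIntegral_mono_set ?_ (Filter.Eventually.of_forall fun _ => Real.exp_nonneg _)
    h.eventuallyLE
  exact ContinuousOn.integrableOn_compact (isCompact_cube a) (by fun_prop)

end Transformed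

end Gaussian

/-! ### `M` as a covariance matrix -/

section Covariance

variable {v k : ℕ} {p q : Fin v}

theorem prod_range_cast_sub (n j : ℕ) :
    ∏ i ∈ Finset.range j, ((n : ℝ) - i) = (n.descFactorial j : ℝ) := by
  induction j with
  | zero => simp
  | succ j ih =>
    rw [Finset.prod_range_succ, ih, Nat.descFactorial_succ]
    rcases le_or_gt j n with h | h
    · push_cast [Nat.cast_sub h]; ring
    · rw [Nat.descFactorial_eq_zero_iff_lt.2 h]; simp

theorem coeffC_eq (v k j : ℕ) : coeffC v k j = (k.choose j : ℝ) / (v.choose j : ℝ) := by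
  have hj : ((j.factorial : ℕ) : ℝ) ≠ 0 := by exact_mod_cast j.factorial_ne_zero
  rw [coeffC, prod_range_cast_sub, prod_range_cast_sub, Nat.descFactorial_eq_factorial_mul_choose,
    Nat.descFactorial_eq_factorial_mul_choose, Nat.cast_mul, Nat.cast_mul,
    mul_div_mul_left _ _ hj]

/-- There are `(v - u).choose (k - u)` supersets, `u = U.card`; the product form avoids division and
holds also for `k < u` and `v < k`. -/
theorem card_supersets (U : Finset (Fin v)) :
    (Finset.univ.filter fun y : Column v k => U ⊆ supp y).card * v.choose U.card =
      v.choose k * k.choose U.card := by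
  have h1 : (Finset.univ.filter fun y : Column v k => U ⊆ supp y).card =
      ((Finset.univ.filter fun K : Finset (Fin v) => K.card = k ∧ U ⊆ K)).card := by
    refine Finset.card_bij (fun y _ => supp y) ?_ ?_ ?_
    · intro y hy
      exact Finset.mem_filter.2 ⟨Finset.mem_univ _, card_supp y, (Finset.mem_filter.1 hy).2⟩
    · intro y _ y' _ h
      exact (columnEquiv v k).injective (Subtype.ext h)
    · intro K hK
      obtain ⟨-, hK1, hK2⟩ := Finset.mem_filter.1 hK
      have : supp ((columnEquiv v k).symm ⟨K, hK1⟩) = K :=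
        congrArg Subtype.val ((columnEquiv v k).apply_symm_apply ⟨K, hK1⟩)
      exact ⟨(columnEquiv v k).symm ⟨K, hK1⟩,
        Finset.mem_filter.2 ⟨Finset.mem_univ _, by rw [this]; exact hK2⟩, this⟩
  rw [h1]
  rcases lt_or_ge k U.card with hlt | hle
  · rw [Nat.choose_eq_zero_of_lt hlt, mul_zero, Finset.card_eq_zero.2, zero_mul]
    refine Finset.filter_eq_empty_iff.2 fun K _ h => ?_
    have := Finset.card_le_card h.2
    omega
  · have h2 : ((Finset.univ.filter fun K : Finset (Fin v) => K.card = k ∧ U ⊆ K)).card =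
        (Uᶜ.powersetCard (k - U.card)).card := by
      refine Finset.card_bij (fun K _ => K \ U) ?_ ?_ ?_
      · intro K hK
        obtain ⟨-, hK1, hK2⟩ := Finset.mem_filter.1 hK
        refine Finset.mem_powersetCard.2 ⟨fun x hx => ?_, ?_⟩
        · exact Finset.mem_compl.2 (Finset.mem_sdiff.1 hx).2
        · rw [Finset.card_sdiff_of_subset hK2, hK1]
      · intro K hK L hL h
        obtain ⟨-, -, hK2⟩ := Finset.mem_filter.1 hK
        obtain ⟨-, -, hL2⟩ := Finset.mem_filter.1 hL
        rw [← Finset.sdiff_union_of_subset hK2, ← Finset.sdiff_union_of_subset hL2, h]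
      · intro T hT
        obtain ⟨hT1, hT2⟩ := Finset.mem_powersetCard.1 hT
        have hd : Disjoint T U := by
          rw [Finset.disjoint_left]
          exact fun x hx => Finset.mem_compl.1 (hT1 hx)
        refine ⟨T ∪ U, Finset.mem_filter.2 ⟨Finset.mem_univ _, ?_, Finset.subset_union_right⟩, ?_⟩
        · rw [Finset.card_union_of_disjoint hd, hT2]; omega
        · rw [Finset.union_sdiff_right, Finset.sdiff_eq_self_of_disjoint hd]
    rw [h2, Finset.card_powersetCard, Finset.card_compl, Fintype.card_fin, mul_comm]
    have hUv : U.card ≤ v := by simpa using Finset.card_le_univ U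
    rcases lt_or_ge v k with hvk | hvk
    · rw [Nat.choose_eq_zero_of_lt hvk, Nat.choose_eq_zero_of_lt (by omega : v - U.card < k - U.card)]
      simp
    · exact (Nat.choose_mul hle).symm

theorem avg_superset (hkv : k ≤ v) (U : Finset (Fin v)) :
    (v.choose k : ℝ)⁻¹ * ∑ y : Column v k, (if U ⊆ supp y then (1 : ℝ) else 0) =
      coeffC v k U.card := by
  have hUv : U.card ≤ v := by simpa using Finset.card_le_univ U
  have h1 : (v.choose k : ℝ) ≠ 0 := by exact_mod_cast (Nat.choose_pos hkv).ne'
  have h2 : (v.choose U.card : ℝ) ≠ 0 := by exact_mod_cast (Nat.choose_pos hUv).ne'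
  rw [Finset.sum_boole, coeffC_eq, eq_div_iff h2, mul_assoc, inv_mul_eq_iff_eq_mul₀ h1]
  exact_mod_cast card_supersets U

theorem coeffC_two (v k : ℕ) :
    coeffC v k 2 = ((k : ℝ) * (k - 1)) / ((v : ℝ) * (v - 1)) := by
  simp [coeffC, Finset.prod_range_succ]

theorem card_column_ne_zero (hkv : k ≤ v) : (v.choose k : ℝ) ≠ 0 := by
  exact_mod_cast (Nat.choose_pos hkv).ne'

theorem avg_centered (hkv : k ≤ v) (S : Pair v) :
    ∑ y : Column v k, (Z y S - coeffC v k 2) = 0 := by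
  have h := avg_superset hkv S.1
  have h0 := card_column_ne_zero hkv
  rw [S.2, inv_mul_eq_iff_eq_mul₀ h0] at h
  simp only [Z_eq_ite]
  rw [Finset.sum_sub_distrib, h, Finset.sum_const, Finset.card_univ, card_column, nsmul_eq_mul,
    sub_self]

theorem avg_covariance (hkv : k ≤ v) (S T : Pair v) :
    (v.choose k : ℝ)⁻¹ * ∑ y : Column v k, (Z y S - coeffC v k 2) * (Z y T - coeffC v k 2) =
      matN v k S T := by
  have h0 := card_column_ne_zero hkv
  have h1 : ∀ y : Column v k, (Z y S - coeffC v k 2) * (Z y T - coeffC v k 2) =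
      (if S.1 ∪ T.1 ⊆ supp y then 1 else 0) - coeffC v k 2 * (Z y S - coeffC v k 2)
        - coeffC v k 2 * (Z y T - coeffC v k 2) - coeffC v k 2 ^ 2 := by
    intro y
    have : Z y S * Z y T = if S.1 ∪ T.1 ⊆ supp y then 1 else 0 := by
      rw [Z_eq_ite, Z_eq_ite, if_congr Finset.union_subset_iff rfl rfl, ite_and]
      split_ifs <;> simp
    rw [← this]
    ring
  simp only [h1]
  rw [Finset.sum_sub_distrib, Finset.sum_sub_distrib, Finset.sum_sub_distrib, ← Finset.mul_sum,
    ← Finset.mul_sum, avg_centered hkv, avg_centered hkv, mul_zero, sub_zero, sub_zero, mul_sub,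
    avg_superset hkv, Finset.sum_const, Finset.card_univ, card_column, nsmul_eq_mul,
    inv_mul_cancel_left₀ h0]
  have hc := Finset.card_union_add_card_inter S.1 T.1
  rw [S.2, T.2] at hc
  have hle : (S.1 ∩ T.1).card ≤ 2 :=
    (Finset.card_le_card Finset.inter_subset_left).trans_eq S.2
  simp only [matN, Matrix.of_apply]
  split_ifs with h2 h1
  · rw [show (S.1 ∪ T.1).card = 2 by omega]
  · rw [show (S.1 ∪ T.1).card = 3 by omega]
  · rw [show (S.1 ∪ T.1).card = 4 by omega]

/-- The centered linear form `θ · (Z(y) - E Z)`. -/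
noncomputable def centeredForm (θ : Pair' v → ℝ) (y : Column v k) : ℝ :=
  ∑ S, θ S * (Z y S.1 - coeffC v k 2)

theorem sum_centeredForm (hkv : k ≤ v) (θ : Pair' v → ℝ) :
    ∑ y : Column v k, centeredForm θ y = 0 := by
  simp only [centeredForm]
  rw [Finset.sum_comm]
  simp only [← Finset.mul_sum, avg_centered hkv, mul_zero, Finset.sum_const_zero]

theorem avgSq_centeredForm (hkv : k ≤ v) (θ : Pair' v → ℝ) :
    avgSq (centeredForm (k := k) θ) = θ ⬝ᵥ (matM v k).mulVec θ := by
  rw [avgSq, card_column]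
  have h1 : ∀ y : Column v k, centeredForm θ y ^ 2 = ∑ S : Pair' v, ∑ T : Pair' v,
      θ S * θ T * ((Z y S.1 - coeffC v k 2) * (Z y T.1 - coeffC v k 2)) := by
    intro y
    rw [sq, centeredForm, Finset.sum_mul_sum]
    exact Finset.sum_congr rfl fun S _ => Finset.sum_congr rfl fun T _ => by ring
  simp only [h1]
  rw [Finset.sum_comm, Finset.mul_sum]
  simp only [dotProduct, Matrix.mulVec]
  refine Finset.sum_congr rfl fun S _ => ?_
  rw [Finset.sum_comm, Finset.mul_sum, Finset.mul_sum]
  refine Finset.sum_congr rfl fun T _ => ?_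
  rw [← Finset.mul_sum, mul_left_comm, avg_covariance hkv]
  simp only [matM, Matrix.submatrix_apply]
  ring

theorem centeredForm_eq (θ : Pair' v → ℝ) (y : Column v k) :
    centeredForm θ y =
      pairSum (ext θ) (supp y) - coeffC v k 2 * pairSum (ext θ) Finset.univ := by
  rw [pairSum_ext_eq, pairSum_ext_eq, Finset.mul_sum, ← Finset.sum_sub_distrib, centeredForm]
  refine Finset.sum_congr rfl fun S _ => ?_
  rw [Z_eq_ite, if_pos (Finset.subset_univ _)]
  split_ifs <;> ring

/-- The quadratic form is the variance of `centeredForm θ`. If it vanishes, all `k`-sums of `ext θ`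
agree, and as `ext θ` is zero on the last pair it is zero on every pair. -/
theorem matM_posDef (hk : 2 ≤ k) (hvk : k + 2 ≤ v) (hl : lastPair v = {p, q}) (hpq : p ≠ q) :
    (matM v k).PosDef := by
  have hkv : k ≤ v := by omega
  refine Matrix.PosDef.of_dotProduct_mulVec_pos ?_ ?_
  · ext S T
    simp only [matM, matN, Matrix.conjTranspose_apply, Matrix.submatrix_apply, Matrix.of_apply,
      star_trivial, Finset.inter_comm]
  · intro θ hθ
    rw [star_trivial, ← avgSq_centeredForm hkv]
    refine lt_of_le_of_ne avgSq_nonneg fun h => hθ ?_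
    have hn : (0 : ℝ) < (Fintype.card (Column v k) : ℝ)⁻¹ := by
      rw [card_column]
      exact inv_pos.2 (by exact_mod_cast Nat.choose_pos hkv)
    have h0 : ∑ y : Column v k, centeredForm θ y ^ 2 = 0 := by
      rcases mul_eq_zero.1 h.symm with h | h
      · exact absurd h hn.ne'
      · exact h
    have h1 : ∀ y : Column v k, centeredForm θ y = 0 := fun y =>
      pow_eq_zero_iff (two_ne_zero) |>.1
        ((Finset.sum_eq_zero_iff_of_nonneg fun _ _ => sq_nonneg _).1 h0 y (Finset.mem_univ y))
    have h2 : ∀ K : Finset (Fin v), K.card = k →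
        pairSum (ext θ) K = coeffC v k 2 * pairSum (ext θ) Finset.univ := by
      intro K hK
      have hs : supp ((columnEquiv v k).symm ⟨K, hK⟩) = K :=
        congrArg Subtype.val ((columnEquiv v k).apply_symm_apply ⟨K, hK⟩)
      have := h1 ((columnEquiv v k).symm ⟨K, hK⟩)
      rw [centeredForm_eq, hs] at this
      linarith
    funext S
    obtain ⟨a, b, hab, hS⟩ := Finset.card_eq_two.1 S.1.2
    have := eq_zero_of_pairSum_const (f := ext θ) hk (by simpa using hvk)
      (fun K L hK hL => by rw [h2 K hK, h2 L hL]) hpq (by rw [← hl, ext_lastPair]) hab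
    rw [← hS, ext_coe] at this
    exact this

theorem exists_posDef_sqrt {ι : Type*} [Fintype ι] [DecidableEq ι] {M : Matrix ι ι ℝ}
    (hM : M.PosDef) : ∃ P : Matrix ι ι ℝ, P.PosDef ∧ P * P = M := by
  open scoped MatrixOrder Matrix.Norms.L2Operator in
  have h0 : 0 ≤ M := hM.posSemidef.nonneg
  have hmul : CFC.sqrt M * CFC.sqrt M = M := CFC.sqrt_mul_sqrt_self M h0
  refine ⟨CFC.sqrt M, ?_, hmul⟩
  have hpsd : (CFC.sqrt M).PosSemidef := Matrix.nonneg_iff_posSemidef.1 (CFC.sqrt_nonneg M)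
  refine hpsd.posDef_iff_isUnit.2 ?_
  rw [Matrix.isUnit_iff_isUnit_det]
  have hd := hM.det_pos
  rw [← hmul, Matrix.det_mul] at hd
  exact (left_ne_zero_of_mul hd.ne').isUnit

theorem abs_mulVec_le {ι : Type*} [Fintype ι] (P : Matrix ι ι ℝ) {x : ι → ℝ} {r : ℝ}
    (hr : 0 ≤ r) (hx : ∀ i, |x i| ≤ r) (i : ι) :
    |P.mulVec x i| ≤ (1 + ∑ i, ∑ j, |P i j|) * r := by
  calc |P.mulVec x i| ≤ ∑ j, |P i j * x j| := Finset.abs_sum_le_sum_abs _ _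
    _ ≤ ∑ j, |P i j| * r := by
        refine Finset.sum_le_sum fun j _ => ?_
        rw [abs_mul]
        exact mul_le_mul_of_nonneg_left (hx j) (abs_nonneg _)
    _ = (∑ j, |P i j|) * r := by rw [Finset.sum_mul]
    _ ≤ _ := by
        refine mul_le_mul_of_nonneg_right ?_ hr
        have : ∑ j, |P i j| ≤ ∑ i, ∑ j, |P i j| :=
          Finset.single_le_sum (f := fun i => ∑ j, |P i j|)
            (fun i _ => Finset.sum_nonneg fun j _ => abs_nonneg (P i j)) (Finset.mem_univ i)
        linarith

/-- `D₂` bounds `P` and `D₁⁻¹` bounds `P⁻¹` in the sup norm; the added `1` keeps the constants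
positive. -/
theorem exists_isScalingPair (hM : (matM v k).PosDef) :
    ∃ D₁ D₂ : ℝ, IsScalingPair v k D₁ D₂ := by
  obtain ⟨P, hP, hPM⟩ := exists_posDef_sqrt hM
  have hu : IsUnit P.det := hP.det_pos.ne'.isUnit
  have pos : ∀ Q : Matrix (Pair' v) (Pair' v) ℝ, 0 < 1 + ∑ i, ∑ j, |Q i j| := fun Q => by
    positivity
  refine ⟨(1 + ∑ i, ∑ j, |P⁻¹ i j|)⁻¹, 1 + ∑ i, ∑ j, |P i j|, inv_pos.2 (pos _), pos _, P, hP, hPM,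
    fun δ hδ => ⟨fun x hx => ⟨P⁻¹.mulVec x, fun S => ?_, ?_⟩, ?_⟩⟩
  · have := abs_mulVec_le P⁻¹ (mul_pos (inv_pos.2 (pos P⁻¹)) hδ).le hx S
    rwa [mul_inv_cancel_left₀ (pos _).ne'] at this
  · rw [Matrix.mulVec_mulVec, Matrix.mul_nonsing_inv _ hu, Matrix.one_mulVec]
  · rintro _ ⟨x, hx, rfl⟩
    exact fun S => abs_mulVec_le P hδ.le hx S

theorem coeffC_two_mem (hk : 2 ≤ k) (hkv : k ≤ v) : 0 ≤ coeffC v k 2 ∧ coeffC v k 2 ≤ 1 := by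
  have hk' : (2 : ℝ) ≤ k := by exact_mod_cast hk
  have hv' : (k : ℝ) ≤ v := by exact_mod_cast hkv
  rw [coeffC_two]
  constructor
  · apply div_nonneg <;> nlinarith
  · rw [div_le_one (by nlinarith)]
    nlinarith

theorem abs_centeredForm_le (hk : 2 ≤ k) (hkv : k ≤ v) (hl : lastPair v = {p, q}) (hpq : p ≠ q)
    {θ : Pair' v → ℝ} {δ : ℝ} (hδ : 0 ≤ δ) (hθ : ∀ S, |θ S| ≤ δ) (y : Column v k) :
    |centeredForm θ y| ≤ dim v * δ := by
  obtain ⟨hc0, hc1⟩ := coeffC_two_mem hk hkv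
  calc |centeredForm θ y| ≤ ∑ S : Pair' v, |θ S * (Z y S.1 - coeffC v k 2)| :=
        Finset.abs_sum_le_sum_abs _ _
    _ ≤ ∑ _S : Pair' v, δ := by
        refine Finset.sum_le_sum fun S _ => ?_
        rw [abs_mul]
        have : |Z y S.1 - coeffC v k 2| ≤ 1 := by
          rw [Z_eq_ite, abs_le]
          split_ifs <;> constructor <;> linarith
        calc |θ S| * |Z y S.1 - coeffC v k 2| ≤ δ * 1 :=
              mul_le_mul (hθ S) this (abs_nonneg _) hδ
          _ = δ := mul_one δ
    _ ≤ dim v * δ := by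
        rw [Finset.sum_const, Finset.card_univ, card_pair' hl hpq, nsmul_eq_mul]
        gcongr
        omega

end Covariance

/-! ### Decay away from the centers -/

section Minor

variable {v k : ℕ} {p q : Fin v}

theorem norm_circExp_add_le {u w : Circ} {c : ℝ} (hc : 0 ≤ c) (h : c ≤ ‖u - w‖) :
    ‖circExp u + circExp w‖ ≤ 2 * Real.cos (c / 2) := by
  obtain ⟨x, hx, hx'⟩ := exists_real_lift (u - w)
  have hxpi : |x| ≤ Real.pi := by
    rw [hx']
    have := AddCircle.norm_le_half_period (2 * Real.pi) (x := u - w) Real.two_pi_pos.ne'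
    rw [abs_of_pos Real.two_pi_pos] at this
    linarith
  have h1 : circExp u + circExp w = circExp w * (1 + Complex.exp (x * Complex.I)) := by
    rw [← circExp_coe, hx, mul_add, ← circExp_add, mul_one, add_sub_cancel, add_comm]
  have h2 : ‖1 + Complex.exp (x * Complex.I)‖ = 2 * Real.cos (x / 2) := by
    have hcos : 0 ≤ Real.cos (x / 2) := by
      apply Real.cos_nonneg_of_mem_Icc
      constructor <;> linarith [(abs_le.1 hxpi).1, (abs_le.1 hxpi).2]
    rw [Complex.norm_eq_sqrt_sq_add_sq, ← Real.sqrt_sq (by linarith : 0 ≤ 2 * Real.cos (x / 2))]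
    congr 1
    rw [Complex.add_re, Complex.add_im, Complex.exp_ofReal_mul_I_re, Complex.exp_ofReal_mul_I_im,
      mul_pow, Real.cos_sq (x / 2), mul_div_cancel₀ x two_ne_zero, Complex.one_re, Complex.one_im]
    linear_combination Real.sin_sq_add_cos_sq x
  rw [h1, norm_mul, norm_circExp, one_mul, h2, ← Real.cos_abs (x / 2), abs_div, abs_two]
  have : Real.cos (|x| / 2) ≤ Real.cos (c / 2) := by
    apply Real.cos_le_cos_of_nonneg_of_le_pi
    · linarith
    · linarith [Real.pi_pos]
    · rw [← hx'] at h
      linarith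
  linarith

/-- Two of the `v.choose k` unit vectors point in different directions and partly cancel; the others
are bounded by one. -/
theorem norm_stepChar_le_of_pair (hkv : k ≤ v) {θ : Pair' v → Circ} {K L : Finset (Fin v)}
    (hK : K.card = k) (hL : L.card = k) {c : ℝ} (hc : 0 < c)
    (h : c ≤ ‖pairSum (ext θ) K - pairSum (ext θ) L‖) :
    ‖stepChar k θ‖ ≤ 1 - (v.choose k : ℝ)⁻¹ * (2 - 2 * Real.cos (c / 2)) := by
  have hn : (0 : ℝ) < v.choose k := by exact_mod_cast Nat.choose_pos hkv
  have hsupp : ∀ K : Finset (Fin v), ∀ hK : K.card = k,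
      supp ((columnEquiv v k).symm ⟨K, hK⟩) = K := fun K hK =>
    congrArg Subtype.val ((columnEquiv v k).apply_symm_apply ⟨K, hK⟩)
  set y := (columnEquiv v k).symm ⟨K, hK⟩ with hy
  set z := (columnEquiv v k).symm ⟨L, hL⟩ with hz
  have hyz : y ≠ z := by
    intro hyz
    have : K = L := by rw [← hsupp K hK, ← hsupp L hL, ← hy, ← hz, hyz]
    rw [this, sub_self, norm_zero] at h
    linarith
  have hsum : ‖∑ y : Column v k, circExp (pairSum (ext θ) (supp y))‖ ≤
      (v.choose k : ℝ) - 2 + 2 * Real.cos (c / 2) := by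
    rw [← Finset.sum_add_sum_compl {y, z}]
    refine (norm_add_le _ _).trans ?_
    have h1 : ‖∑ y ∈ ({y, z} : Finset (Column v k)), circExp (pairSum (ext θ) (supp y))‖ ≤
        2 * Real.cos (c / 2) := by
      rw [Finset.sum_pair hyz, hy, hz, hsupp, hsupp]
      exact norm_circExp_add_le hc.le h
    have h2 : ‖∑ y ∈ ({y, z} : Finset (Column v k))ᶜ, circExp (pairSum (ext θ) (supp y))‖ ≤
        (v.choose k : ℝ) - 2 := by
      refine (norm_sum_le _ _).trans ?_
      simp only [norm_circExp]
      rw [Finset.sum_const, nsmul_eq_mul, mul_one]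
      have := Finset.card_add_card_compl ({y, z} : Finset (Column v k))
      rw [Finset.card_pair hyz, card_column] at this
      have : (2 : ℝ) + (({y, z} : Finset (Column v k))ᶜ.card : ℝ) = v.choose k := by
        exact_mod_cast this
      linarith
    linarith
  rw [stepChar, norm_mul, norm_inv, Complex.norm_natCast]
  calc (v.choose k : ℝ)⁻¹ * _ ≤ (v.choose k : ℝ)⁻¹ *
        ((v.choose k : ℝ) - 2 + 2 * Real.cos (c / 2)) := by gcongr
    _ = _ := by field_simp; ring

theorem norm_stepChar_le (hk : 2 ≤ k) (hvk : k + 2 ≤ v) (hl : lastPair v = {p, q}) (hpq : p ≠ q)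
    {δ : ℝ} (hδ : 0 < δ) (hδ1 : δ ≤ 1) (hδk : 2 * δ < 2 * Real.pi / (k - 1 : ℕ))
    {θ : Pair' v → Circ} (hθ : ∀ m : CenterIndex k p, θ ∉ Metric.closedBall (center q m) δ) :
    ‖stepChar k θ‖ ≤ Real.exp (-((v.choose k : ℝ)⁻¹ * (11 / 768) * δ ^ 2)) := by
  have hkv : k ≤ v := by omega
  have hn : (0 : ℝ) < (v.choose k : ℝ)⁻¹ := inv_pos.2 (by exact_mod_cast Nat.choose_pos hkv)
  obtain ⟨K, L, hK, hL, hKL⟩ : ∃ K L : Finset (Fin v), K.card = k ∧ L.card = k ∧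
      δ / 4 < ‖pairSum (ext θ) K - pairSum (ext θ) L‖ := by
    by_contra! hc
    -- The choice `η = δ/4` turns the approximation error `4η` into the radius `δ`.
    obtain ⟨m, hm⟩ := exists_center hk hvk hl hpq (η := δ / 4) (by linarith) (by linarith) hc
    refine hθ m ?_
    rw [Metric.mem_closedBall, dist_pi_le_iff hδ.le]
    intro S
    rw [dist_eq_norm]
    exact (hm S).trans_eq (by ring)
  have h := norm_stepChar_le_of_pair hkv hK hL (by linarith) hKL.le
  have hcos := (abs_le.1 (Real.cos_bound (x := δ / 4 / 2)
    (by rw [abs_of_pos (by linarith)]; linarith))).2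
  rw [abs_of_pos (by linarith : 0 < δ / 4 / 2)] at hcos
  have h4 : δ ^ 4 ≤ δ ^ 2 := pow_le_pow_of_le_one hδ.le hδ1 (by norm_num)
  -- The main term of `2 - 2 cos(δ/8)` is `δ²/64 = 12/768 δ²`; the quartic error costs less than
  -- `1/768 δ²`.
  have h2 : 11 / 768 * δ ^ 2 ≤ 2 - 2 * Real.cos (δ / 4 / 2) := by nlinarith [sq_nonneg δ]
  have h3 := mul_le_mul_of_nonneg_left h2 hn.le
  have h5 := Real.add_one_le_exp (-((v.choose k : ℝ)⁻¹ * (11 / 768) * δ ^ 2))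
  linarith

end Minor

/-! ### Reduction to one ball around zero -/

section Major

variable {v k t l : ℕ} {p q : Fin v}

theorem pairSum_ext_coe (θ : Pair' v → ℝ) (K : Finset (Fin v)) :
    pairSum (ext fun S => ((θ S : ℝ) : Circ)) K = ((pairSum (ext θ) K : ℝ) : Circ) :=
  pairSum_ext_map (QuotientAddGroup.mk' (AddSubgroup.zmultiples (2 * Real.pi))) θ K

/-- Because `l = t C₂`, the inversion phase splits into `t` equal factors, each of which centers one
step. -/
theorem integrand_coe (hlt : (t : ℝ) * coeffC v k 2 = l) (θ : Pair' v → ℝ) :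
    integrand k t l (fun S => ((θ S : ℝ) : Circ)) = avgExp (centeredForm (k := k) θ) ^ t := by
  have h1 : avgExp (centeredForm (k := k) θ) =
      Complex.exp (-(coeffC v k 2 * pairSum (ext θ) Finset.univ : ℝ) * Complex.I) *
        stepChar k (fun S => ((θ S : ℝ) : Circ)) := by
    rw [avgExp, stepChar, card_column, mul_left_comm]
    congr 1
    rw [Finset.mul_sum]
    refine Finset.sum_congr rfl fun y _ => ?_
    rw [pairSum_ext_coe, circExp_coe, centeredForm_eq, ← Complex.exp_add]
    congr 1
    push_cast
    ring
  rw [h1, mul_pow, integrand, pairSum_ext_coe, ← AddCircle.coe_nsmul, ← AddCircle.coe_neg,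
    circExp_coe, ← Complex.exp_nat_mul, mul_comm]
  congr 2
  rw [nsmul_eq_mul, ← hlt]
  push_cast
  ring

/-- Since `δ < π`, the ball lifts to a cube inside the fundamental domain `(-π, π]^(d-1)`, where the
circle norm is the absolute value. -/
theorem setIntegral_ball_zero {F : (Pair' v → Circ) → ℂ} (hF : Continuous F) {δ : ℝ}
    (hδ : 0 ≤ δ) (hδpi : δ < Real.pi) :
    ∫ θ in Metric.closedBall (0 : Pair' v → Circ) δ, F θ =
      ∫ θ in {θ : Pair' v → ℝ | ∀ S, |θ S| ≤ δ}, F (fun S => ((θ S : ℝ) : Circ)) := by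
  have hmp : MeasurePreserving (fun (θ : Pair' v → ℝ) (S : Pair' v) => ((θ S : ℝ) : Circ))
      (volume.restrict (Set.univ.pi fun _ => Set.Ioc (-Real.pi) (-Real.pi + 2 * Real.pi)))
      volume := by
    rw [volume_pi, Measure.restrict_pi_pi, volume_pi]
    exact measurePreserving_pi _ _ fun _ => AddCircle.measurePreserving_mk (2 * Real.pi) (-Real.pi)
  have hball : MeasurableSet (Metric.closedBall (0 : Pair' v → Circ) δ) :=
    Metric.isClosed_closedBall.measurableSet
  have hcube : MeasurableSet {θ : Pair' v → ℝ | ∀ S, |θ S| ≤ δ} := (isCompact_cube δ).measurableSet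
  rw [← integral_indicator hball, ← hmp.map_eq, integral_map hmp.measurable.aemeasurable
    (hF.stronglyMeasurable.indicator hball).aestronglyMeasurable]
  have hcongr : ∀ θ ∈ Set.univ.pi fun _ : Pair' v => Set.Ioc (-Real.pi) (-Real.pi + 2 * Real.pi),
      (Metric.closedBall (0 : Pair' v → Circ) δ).indicator F (fun S => ((θ S : ℝ) : Circ)) =
      {θ : Pair' v → ℝ | ∀ S, |θ S| ≤ δ}.indicator (fun θ => F fun S => ((θ S : ℝ) : Circ)) θ := by
    intro θ hθ
    have hmem : (fun S => ((θ S : ℝ) : Circ)) ∈ Metric.closedBall (0 : Pair' v → Circ) δ ↔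
        θ ∈ {θ : Pair' v → ℝ | ∀ S, |θ S| ≤ δ} := by
      rw [Metric.mem_closedBall, dist_pi_le_iff hδ]
      refine forall_congr' fun S => ?_
      have h1 := hθ S (Set.mem_univ S)
      rw [Pi.zero_apply, dist_zero_right, (AddCircle.norm_coe_eq_abs_iff (2 * Real.pi)
        Real.two_pi_pos.ne').2]
      rw [abs_of_pos Real.two_pi_pos, abs_le]
      constructor <;> linarith [h1.1, h1.2]
    by_cases h : θ ∈ {θ : Pair' v → ℝ | ∀ S, |θ S| ≤ δ}
    · rw [Set.indicator_of_mem h, Set.indicator_of_mem (hmem.2 h)]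
    · rw [Set.indicator_of_notMem h, Set.indicator_of_notMem (mt hmem.1 h)]
  rw [setIntegral_congr_fun (MeasurableSet.univ_pi fun _ => measurableSet_Ioc) hcongr,
    setIntegral_indicator hcube]
  congr 2
  refine Set.inter_eq_right.2 fun θ hθ S _ => ?_
  have := abs_le.1 (hθ S)
  constructor <;> linarith [this.1, this.2]

theorem setIntegral_ball_center (hk : 2 ≤ k) (hv : 1 ≤ v) (hl : lastPair v = {p, q})
    (hpq : p ≠ q) {r : ℕ} (h1 : l * (v - 1) = r * (k - 1))
    (h2 : l * v.choose 2 = t * k.choose 2) (m : CenterIndex k p) (δ : ℝ) :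
    ∫ θ in Metric.closedBall (center q m) δ, integrand k t l θ =
      ∫ θ in Metric.closedBall (0 : Pair' v → Circ) δ, integrand k t l θ := by
  have h := (measurePreserving_add_left (volume : Measure (Pair' v → Circ))
    (center q m)).setIntegral_preimage_emb (measurableEmbedding_addLeft (center q m))
    (integrand k t l) (Metric.closedBall (center q m) δ)
  rw [← h]
  simp only [integrand_center_add hk hv hl hpq h1 h2]
  congr 2
  ext θ
  simp [dist_eq_norm]

theorem integral_integrand_split (hk : 2 ≤ k) (hv : 3 ≤ v) (hl : lastPair v = {p, q})
    (hpq : p ≠ q) {r : ℕ} (h1 : l * (v - 1) = r * (k - 1))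
    (h2 : l * v.choose 2 = t * k.choose 2) {δ : ℝ} (hδ : 0 < δ)
    (hδk : 2 * δ < 2 * Real.pi / (k - 1 : ℕ)) :
    ∫ θ : Pair' v → Circ, integrand k t l θ =
      ((k - 1 : ℕ) : ℂ) ^ (v - 1) *
        (∫ θ in Metric.closedBall (0 : Pair' v → Circ) δ, integrand k t l θ) +
      ∫ θ in (⋃ m : CenterIndex k p, Metric.closedBall (center q m) δ)ᶜ, integrand k t l θ := by
  have hint : Integrable (integrand k t l : (Pair' v → Circ) → ℂ) :=
    (continuous_integrand t l).integrable_of_hasCompactSupport (HasCompactSupport.of_compactSpace _)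
  have hmeas : ∀ m : CenterIndex k p, MeasurableSet (Metric.closedBall (center q m) δ) :=
    fun m => Metric.isClosed_closedBall.measurableSet
  rw [← integral_add_compl (MeasurableSet.iUnion hmeas) hint]
  congr 1
  rw [integral_iUnion_fintype hmeas _ fun m => hint.integrableOn]
  · simp only [setIntegral_ball_center hk (by omega : 1 ≤ v) hl hpq h1 h2]
    rw [Finset.sum_const, Finset.card_univ, card_centerIndex, nsmul_eq_mul]
    push_cast
    rfl
  -- The balls are disjoint: centers are at least `2π/(k-1) > 2δ` apart in some coordinate.
  · intro m m' hm
    rw [Function.onFun, Set.disjoint_left]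
    intro θ hθ hθ'
    obtain ⟨S, hS⟩ := center_separated hk hv hl hpq hm
    rw [Metric.mem_closedBall, dist_pi_le_iff hδ.le] at hθ hθ'
    have e1 := hθ S
    have e2 := hθ' S
    rw [← dist_eq_norm] at hS
    have := dist_triangle_left (center q m S) (center q m' S) (θ S)
    linarith

theorem norm_minor_le (hk : 2 ≤ k) (hvk : k + 2 ≤ v) (hl : lastPair v = {p, q}) (hpq : p ≠ q)
    {δ : ℝ} (hδ : 0 < δ) (hδ1 : δ ≤ 1) (hδk : 2 * δ < 2 * Real.pi / (k - 1 : ℕ)) :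
    ‖∫ θ in (⋃ m : CenterIndex k p, Metric.closedBall (center q m) δ)ᶜ, integrand k t l θ‖ ≤
      errorTerm v k t δ * (2 * Real.pi) ^ Fintype.card (Pair' v) := by
  have hvol : (volume : Measure (Pair' v → Circ)).real Set.univ =
      (2 * Real.pi) ^ Fintype.card (Pair' v) := by
    rw [measureReal_def, volume_pi, Measure.pi_univ]
    simp [AddCircle.measure_univ, Real.pi_pos.le]
  have herr : 0 ≤ errorTerm v k t δ := Real.exp_nonneg _
  rw [← hvol]
  refine (norm_setIntegral_le_of_norm_le_const (C := errorTerm v k t δ)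
    (measure_lt_top _ _) fun θ hθ => ?_).trans ?_
  · rw [norm_integrand]
    have h := norm_stepChar_le hk hvk hl hpq hδ hδ1 hδk (θ := θ) fun m hm =>
      hθ (Set.mem_iUnion.2 ⟨m, hm⟩)
    refine (pow_le_pow_left₀ (norm_nonneg _) h t).trans_eq ?_
    rw [← Real.exp_nat_mul, errorTerm]
    congr 1
    ring
  · exact mul_le_mul_of_nonneg_left (measureReal_mono (Set.subset_univ _)) herr

/-- The contribution of one major arc. -/
noncomputable def majorArc (k t : ℕ) (v : ℕ) (δ : ℝ) : ℝ :=
  ∫ θ in {θ : Pair' v → ℝ | ∀ S, |θ S| ≤ δ}, (avgExp (centeredForm (k := k) θ) ^ t).re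

theorem continuous_avgExp_centeredForm (t : ℕ) :
    Continuous fun θ : Pair' v → ℝ => avgExp (centeredForm (k := k) θ) ^ t := by
  unfold avgExp centeredForm
  fun_prop

theorem abs_returnProb_sub_le (hk : 2 ≤ k) (hvk : k + 2 ≤ v) (hl : lastPair v = {p, q})
    (hpq : p ≠ q) {r : ℕ} (h1 : l * (v - 1) = r * (k - 1)) (h2 : l * v.choose 2 = t * k.choose 2)
    (hlt : (t : ℝ) * coeffC v k 2 = l) {δ : ℝ} (hδ : 0 < δ) (hδ1 : δ ≤ 1)
    (hδk : 2 * δ < 2 * Real.pi / (k - 1 : ℕ)) :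
    |returnProb v k t - ((2 * Real.pi) ^ Fintype.card (Pair' v))⁻¹ *
      (((k : ℝ) - 1) ^ (v - 1) * majorArc k t v δ)| ≤ errorTerm v k t δ := by
  have hδpi : δ < Real.pi := by linarith [Real.pi_gt_three]
  have hpow : (0 : ℝ) < (2 * Real.pi) ^ Fintype.card (Pair' v) := pow_pos Real.two_pi_pos _
  have hP := returnProb_eq_integral (t := t) (by omega : k ≤ v) (by omega) hl hpq (l := l)
    (by rw [← coeffC_two]; exact hlt)
  rw [integral_integrand_split hk (by omega) hl hpq h1 h2 hδ hδk,
    setIntegral_ball_zero (continuous_integrand t l) hδ.le hδpi] at hP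
  simp only [integrand_coe hlt] at hP
  have hint : IntegrableOn (fun θ : Pair' v → ℝ => avgExp (centeredForm (k := k) θ) ^ t)
      {θ : Pair' v → ℝ | ∀ S, |θ S| ≤ δ} :=
    (continuous_avgExp_centeredForm t).continuousOn.integrableOn_compact (isCompact_cube δ)
  have hre : (∫ θ in {θ : Pair' v → ℝ | ∀ S, |θ S| ≤ δ},
      avgExp (centeredForm (k := k) θ) ^ t).re = majorArc k t v δ :=
    (integral_re (𝕜 := ℂ) hint).symm
  have hJ := norm_minor_le (t := t) (l := l) hk hvk hl hpq hδ hδ1 hδk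
  set J := ∫ θ in (⋃ m : CenterIndex k p, Metric.closedBall (center q m) δ)ᶜ, integrand k t l θ
  have hk1 : ((k - 1 : ℕ) : ℝ) = (k : ℝ) - 1 := Nat.cast_pred (by omega)
  have hPre : returnProb v k t = ((2 * Real.pi) ^ Fintype.card (Pair' v))⁻¹ *
      (((k : ℝ) - 1) ^ (v - 1) * majorArc k t v δ + J.re) := by
    have h := congrArg Complex.re hP
    rw [Complex.ofReal_re, ← Complex.ofReal_pow, ← Complex.ofReal_inv, Complex.re_ofReal_mul,
      Complex.add_re, ← Complex.ofReal_natCast, hk1, ← Complex.ofReal_pow, Complex.re_ofReal_mul,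
      hre] at h
    exact h
  have e : returnProb v k t - ((2 * Real.pi) ^ Fintype.card (Pair' v))⁻¹ *
      (((k : ℝ) - 1) ^ (v - 1) * majorArc k t v δ) =
      ((2 * Real.pi) ^ Fintype.card (Pair' v))⁻¹ * J.re := by rw [hPre]; ring
  rw [e, abs_mul, abs_of_pos (inv_pos.2 hpow), inv_mul_le_iff₀ hpow, mul_comm]
  exact (Complex.abs_re_le_norm J).trans hJ

end Major

/-! ### Assembly of the two-sided bound -/

section Bounds

variable {v k t : ℕ} {p q : Fin v} {D₁ D₂ δ : ℝ}

theorem lastPair_eq (hv : 2 ≤ v) :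
    lastPair v = {(⟨v - 2, by omega⟩ : Fin v), (⟨v - 1, by omega⟩ : Fin v)} := by
  ext i
  simp only [lastPair, Finset.mem_filter, Finset.mem_univ, true_and, Finset.mem_insert,
    Finset.mem_singleton, Fin.ext_iff]
  omega

theorem le_majorArc (hk : 2 ≤ k) (hkv : k ≤ v) (hl : lastPair v = {p, q}) (hpq : p ≠ q)
    (hD : IsScalingPair v k D₁ D₂) {P : Matrix (Pair' v) (Pair' v) ℝ} (hP : P.PosDef)
    (hPM : P * P = matM v k) (hsub : box v (D₁ * δ) ⊆ P.mulVec '' box v δ) (ht : 1 ≤ t)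
    (hδ : 0 < δ) (hx : dim v * δ ≤ 1 / 10) (htx : t * (dim v * δ) ^ 3 ≤ 2)
    (hd : 1 ≤ dim v) :
    P.det⁻¹ * ((2 * Real.pi / t) ^ (((dim v - 1 : ℕ) : ℝ) / 2) * factorL v t D₁ δ) ≤
      majorArc k t v δ := by
  have := nonempty_column hkv
  have ht' : (0 : ℝ) < t := by exact_mod_cast ht
  have hg := setIntegral_gaussian_lower (M := matM v k) (c := (t : ℝ) / 2) (a := D₁ * δ) hP hPM
    (by positivity) (mul_pos hD.1 hδ).le hsub
  rw [card_pair' hl hpq] at hg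
  set A : ℝ := (1 + (t : ℝ) ^ 2 * ((dim v : ℝ) * δ) ^ 6) ^ (-(1 / 2) : ℝ)
    * (1 - 1 / 3 * ((dim v : ℝ) * δ) ^ 4) ^ t with hA
  have hx0 : 0 ≤ (dim v : ℝ) * δ := by positivity
  have hA0 : 0 ≤ A := by
    refine mul_nonneg (by positivity) (pow_nonneg ?_ _)
    have : ((dim v : ℝ) * δ) ^ 4 ≤ (1 / 10) ^ 4 := by gcongr
    linarith
  have hpt : A * ∫ θ in {θ : Pair' v → ℝ | ∀ S, |θ S| ≤ δ},
      Real.exp (-((t : ℝ) / 2) * (θ ⬝ᵥ (matM v k).mulVec θ)) ≤ majorArc k t v δ := by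
    rw [← integral_const_mul, majorArc]
    refine setIntegral_mono_on ?_ ?_ (isCompact_cube δ).measurableSet fun θ hθ => ?_
    · exact ContinuousOn.integrableOn_compact (isCompact_cube δ) (by fun_prop)
    · exact (Complex.continuous_re.comp
        (continuous_avgExp_centeredForm t)).continuousOn.integrableOn_compact (isCompact_cube δ)
    · have h := le_avgExp_pow_re (sum_centeredForm (k := k) hkv θ)
        (abs_centeredForm_le hk hkv hl hpq hδ.le hθ) hx htx
      rw [avgSq_centeredForm hkv, ← Real.exp_nat_mul] at h
      refine le_trans (le_of_eq ?_) h
      rw [hA]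
      congr 2
      ring
  refine le_trans (le_of_eq ?_) ((mul_le_mul_of_nonneg_left hg hA0).trans hpt)
  have e1 : Real.pi / ((t : ℝ) / 2) = 2 * Real.pi / t := by field_simp
  have e2 : -((t : ℝ) / 2) * (D₁ * δ) ^ 2 = -(1 / 2) * (t : ℝ) * (D₁ * δ) ^ 2 := by ring
  rw [e1, e2, factorL, hA, Nat.cast_pred hd]
  ring

theorem majorArc_le (hk : 2 ≤ k) (hkv : k ≤ v) (hl : lastPair v = {p, q}) (hpq : p ≠ q)
    (hD : IsScalingPair v k D₁ D₂) {P : Matrix (Pair' v) (Pair' v) ℝ} (hP : P.PosDef)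
    (hPM : P * P = matM v k) (hsub : P.mulVec '' box v δ ⊆ box v (D₂ * δ)) (ht : 1 ≤ t)
    (hδ : 0 < δ) (hx : dim v * δ ≤ 1 / 10) (hd : 1 ≤ dim v) :
    majorArc k t v δ ≤
      P.det⁻¹ * ((2 * Real.pi / t) ^ (((dim v - 1 : ℕ) : ℝ) / 2) * factorU v t D₂ δ) := by
  have := nonempty_column hkv
  have ht' : (0 : ℝ) < t := by exact_mod_cast ht
  have hdet := hP.det_pos
  have hg := setIntegral_gaussian_upper (M := matM v k) (c := (t : ℝ) / 2) (a := D₂ * δ) hP hPM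
    (by positivity) (mul_pos hD.2.1 hδ).le hsub
  rw [card_pair' hl hpq] at hg
  have hx0 : 0 ≤ (dim v : ℝ) * δ := by positivity
  set A : ℝ := (1 + 1 / 4 * ((dim v : ℝ) * δ) ^ 6) ^ ((t : ℝ) / 2)
    * (1 + 1 / 3 * ((dim v : ℝ) * δ) ^ 4) ^ t with hA
  have hA0 : 0 ≤ A := by positivity
  have hpt : majorArc k t v δ ≤ A * ∫ θ in {θ : Pair' v → ℝ | ∀ S, |θ S| ≤ δ},
      Real.exp (-((t : ℝ) / 2) * (θ ⬝ᵥ (matM v k).mulVec θ)) := by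
    rw [← integral_const_mul, majorArc]
    refine setIntegral_mono_on ?_ ?_ (isCompact_cube δ).measurableSet fun θ hθ => ?_
    · exact (Complex.continuous_re.comp
        (continuous_avgExp_centeredForm t)).continuousOn.integrableOn_compact (isCompact_cube δ)
    · exact ContinuousOn.integrableOn_compact (isCompact_cube δ) (by fun_prop)
    · have h := norm_avgExp_le (sum_centeredForm (k := k) hkv θ)
        (abs_centeredForm_le hk hkv hl hpq hδ.le hθ) hx
      refine (Complex.re_le_norm _).trans ?_
      rw [norm_pow]
      refine (pow_le_pow_left₀ (norm_nonneg _) h t).trans (le_of_eq ?_)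
      rw [mul_pow, mul_pow, avgSq_centeredForm hkv, ← Real.exp_nat_mul, hA, Real.sqrt_eq_rpow,
        ← Real.rpow_mul_natCast (by positivity)]
      congr 2
      · congr 1
        ring
      · ring
  refine hpt.trans ((mul_le_mul_of_nonneg_left hg hA0).trans ?_)
  have e1 : Real.pi / ((t : ℝ) / 2) = 2 * Real.pi / t := by field_simp
  -- The integral gives the exponent `(t/2)(2D₂δ)²`; `U` has twice this, which only enlarges the
  -- bound.
  have hexp : (1 - Real.exp (-((t : ℝ) / 2) * (2 * (D₂ * δ)) ^ 2)) ≤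
      (1 - Real.exp (-(t : ℝ) * (2 * D₂ * δ) ^ 2)) := by
    have : -(t : ℝ) * (2 * D₂ * δ) ^ 2 ≤ -((t : ℝ) / 2) * (2 * (D₂ * δ)) ^ 2 := by
      nlinarith [mul_nonneg ht'.le (sq_nonneg (D₂ * δ))]
    have := Real.exp_le_exp.2 this
    linarith
  have hexp0 : 0 ≤ (1 - Real.exp (-((t : ℝ) / 2) * (2 * (D₂ * δ)) ^ 2)) := by
    have : Real.exp (-((t : ℝ) / 2) * (2 * (D₂ * δ)) ^ 2) ≤ 1 :=
      Real.exp_le_one_iff.2 (by nlinarith [mul_nonneg ht'.le (sq_nonneg (2 * (D₂ * δ)))])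
    linarith
  have hr := Real.rpow_le_rpow hexp0 hexp (by positivity : 0 ≤ ((dim v - 1 : ℕ) : ℝ) / 2)
  rw [e1]
  calc A * (P.det⁻¹ * ((2 * Real.pi / t) ^ (((dim v - 1 : ℕ) : ℝ) / 2) *
        (1 - Real.exp (-((t : ℝ) / 2) * (2 * (D₂ * δ)) ^ 2)) ^ (((dim v - 1 : ℕ) : ℝ) / 2)))
      ≤ A * (P.det⁻¹ * ((2 * Real.pi / t) ^ (((dim v - 1 : ℕ) : ℝ) / 2) *
        (1 - Real.exp (-(t : ℝ) * (2 * D₂ * δ) ^ 2)) ^ (((dim v - 1 : ℕ) : ℝ) / 2))) := by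
        gcongr
    _ = _ := by
        rw [factorU, hA, Nat.cast_pred hd]
        ring

/-- Uses `det P = √(det M)` and `√(2π/t) √(2πt) = 2π`. -/
theorem mainTerm_eq {P : Matrix (Pair' v) (Pair' v) ℝ} (hP : P.PosDef)
    (hPM : P * P = matM v k) (ht : 1 ≤ t) :
    ((2 * Real.pi) ^ (dim v - 1))⁻¹ * (((k : ℝ) - 1) ^ (v - 1) *
      (P.det⁻¹ * (2 * Real.pi / t) ^ (((dim v - 1 : ℕ) : ℝ) / 2))) = mainTerm v k t := by
  have ht' : (0 : ℝ) < t := by exact_mod_cast ht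
  have hdet := hP.det_pos
  have hpi := Real.two_pi_pos
  have h1 : Real.sqrt ((2 * Real.pi * t) ^ (dim v - 1) * (matM v k).det) =
      Real.sqrt (2 * Real.pi * t) ^ (dim v - 1) * P.det := by
    rw [← hPM, Matrix.det_mul, Real.sqrt_mul (by positivity), Real.sqrt_mul_self hdet.le,
      Real.sqrt_eq_rpow, Real.sqrt_eq_rpow, ← Real.rpow_natCast, ← Real.rpow_natCast,
      ← Real.rpow_mul (by positivity), ← Real.rpow_mul (by positivity), mul_comm (1 / 2 : ℝ)]
  have h2 : (2 * Real.pi / t) ^ (((dim v - 1 : ℕ) : ℝ) / 2) =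
      Real.sqrt (2 * Real.pi / t) ^ (dim v - 1) := by
    rw [Real.sqrt_eq_rpow, ← Real.rpow_natCast, ← Real.rpow_mul (by positivity)]
    congr 1
    ring
  have h3 : Real.sqrt (2 * Real.pi / t) * Real.sqrt (2 * Real.pi * t) = 2 * Real.pi := by
    rw [← Real.sqrt_mul (by positivity)]
    have : 2 * Real.pi / t * (2 * Real.pi * t) = (2 * Real.pi) ^ 2 := by field_simp
    rw [this, Real.sqrt_sq hpi.le]
  have h4 : 0 < Real.sqrt (2 * Real.pi * t) := Real.sqrt_pos.2 (by positivity)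
  have h5 : 0 < Real.sqrt (2 * Real.pi / t) := Real.sqrt_pos.2 (by positivity)
  rw [mainTerm, h1, h2]
  generalize Real.sqrt (2 * Real.pi / t) = a at *
  generalize Real.sqrt (2 * Real.pi * t) = b at *
  rw [eq_div_iff (by positivity), ← h3, mul_pow]
  field_simp

theorem le_choose (hk : 1 ≤ k) (hkv : k + 1 ≤ v) : v ≤ v.choose k := by
  induction v with
  | zero => omega
  | succ v ih =>
    rcases Nat.lt_or_ge v (k + 1) with h | h
    · have : v = k := by omega
      subst this
      rw [Nat.choose_succ_self_right]
    · have h1 := ih h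
      obtain ⟨j, rfl⟩ : ∃ j, k = j + 1 := ⟨k - 1, by omega⟩
      rw [Nat.choose_succ_succ']
      have := Nat.choose_pos (n := v) (k := j) (by omega)
      omega

/-- Three consequences of the smallness of `δ`: the cosine expansion applies, the balls are
disjoint, and `|centeredForm| ≤ d δ ≤ 1/10` as the Taylor bounds require. -/
theorem small_of_lt (hk : 2 ≤ k) (hvk : k + 2 ≤ v) (hδ : 0 < δ)
    (h : δ < ((k : ℝ) ^ 2)⁻¹ * ((v.choose k : ℝ) ^ 2)⁻¹
        * (1 / (6 * 96 ^ 2) * (2 * Real.pi / ((k : ℝ) - 1)) ^ 4)) :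
    δ ≤ 1 ∧ 2 * δ < 2 * Real.pi / (k - 1 : ℕ) ∧ dim v * δ ≤ 1 / 10 := by
  have hk' : (2 : ℝ) ≤ k := by exact_mod_cast hk
  have hk1 : ((k - 1 : ℕ) : ℝ) = (k : ℝ) - 1 := Nat.cast_pred (by omega)
  have hn : (v : ℝ) ≤ v.choose k := by exact_mod_cast le_choose (by omega) (by omega)
  have hv : (4 : ℝ) ≤ v := by exact_mod_cast (by omega : 4 ≤ v)
  set n : ℝ := (v.choose k : ℝ)
  set a : ℝ := 2 * Real.pi / ((k : ℝ) - 1) with ha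
  have ha0 : 0 < a := div_pos Real.two_pi_pos (by linarith)
  have ha7 : a ≤ 7 := by
    rw [ha, div_le_iff₀ (by linarith)]
    nlinarith [Real.pi_lt_d2]
  have hn2 : 0 < n ^ 2 := by nlinarith
  have hd : (dim v : ℝ) ≤ n ^ 2 := by
    rw [dim, Nat.cast_choose_two]
    nlinarith
  -- With `a = 2π/(k-1) ≤ 7` one has `a³ / (6 · 96²) ≤ 1/100`; the factor `n²` absorbs `d`, since `d
  -- ≤ v² ≤ n²`.
  have hδn : δ * n ^ 2 ≤ a / 100 := by
    have hk2 : ((k : ℝ) ^ 2)⁻¹ ≤ 1 := inv_le_one_of_one_le₀ (by nlinarith)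
    have h3 : a ^ 3 ≤ 7 ^ 3 := by gcongr
    have h4 : (1 : ℝ) / (6 * 96 ^ 2) * a ^ 4 ≤ a / 100 := by
      have : a ^ 4 = a ^ 3 * a := by ring
      rw [this]
      nlinarith
    calc δ * n ^ 2 ≤ (((k : ℝ) ^ 2)⁻¹ * (n ^ 2)⁻¹ * (1 / (6 * 96 ^ 2) * a ^ 4)) * n ^ 2 := by
          gcongr
      _ = ((k : ℝ) ^ 2)⁻¹ * (1 / (6 * 96 ^ 2) * a ^ 4) * ((n ^ 2)⁻¹ * n ^ 2) := by ring
      _ = ((k : ℝ) ^ 2)⁻¹ * (1 / (6 * 96 ^ 2) * a ^ 4) := by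
          rw [inv_mul_cancel₀ hn2.ne', mul_one]
      _ ≤ 1 * (a / 100) := by gcongr
      _ = a / 100 := one_mul _
  have hn1 : 1 ≤ n ^ 2 := by nlinarith
  have hδa : δ ≤ a / 100 := by nlinarith
  refine ⟨by linarith, by rw [hk1, ← ha]; linarith, ?_⟩
  calc (dim v : ℝ) * δ ≤ n ^ 2 * δ := by gcongr
    _ = δ * n ^ 2 := mul_comm _ _
    _ ≤ 1 / 10 := by linarith

theorem returnProb_bounds (hk : 2 ≤ k) (hvk : k + 2 ≤ v) (hδ : 0 < δ)
    (hδs : δ < ((k : ℝ) ^ 2)⁻¹ * ((v.choose k : ℝ) ^ 2)⁻¹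
        * (1 / (6 * 96 ^ 2) * (2 * Real.pi / ((k : ℝ) - 1)) ^ 4))
    (ht : 2 ≤ t) (htδ : (t : ℝ) < 2 * (((dim v : ℝ) * δ) ^ 3)⁻¹)
    (hint : ∃ m : ℤ, (t : ℝ) * (((k : ℝ) * (k - 1)) / ((v : ℝ) * (v - 1))) = m)
    (hint' : ∃ m : ℤ, (t : ℝ) * ((k : ℝ) / v) = m) (hD : IsScalingPair v k D₁ D₂) :
    returnProb v k t ≤ mainTerm v k t * factorU v t D₂ δ + errorTerm v k t δ ∧
      mainTerm v k t * factorL v t D₁ δ - errorTerm v k t δ ≤ returnProb v k t := by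
  obtain ⟨hδ1, hδk, hx⟩ := small_of_lt hk hvk hδ hδs
  have hl := lastPair_eq (v := v) (by omega)
  have hpq : (⟨v - 2, by omega⟩ : Fin v) ≠ ⟨v - 1, by omega⟩ := by
    rw [Ne, Fin.ext_iff]
    simp only
    omega
  have hk' : (2 : ℝ) ≤ k := by exact_mod_cast hk
  have hv' : (4 : ℝ) ≤ v := by exact_mod_cast (by omega : 4 ≤ v)
  have hv0 : (v : ℝ) ≠ 0 := by linarith
  have hv1 : (v : ℝ) - 1 ≠ 0 := by linarith
  have hd : 1 ≤ dim v := Nat.choose_pos (by omega)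
  have nat_of : ∀ x : ℝ, 0 ≤ x → (∃ m : ℤ, x = m) → ∃ m : ℕ, x = m := by
    rintro x hx ⟨m, hm⟩
    have hm0 : 0 ≤ m := by
      have : (0 : ℝ) ≤ m := hm ▸ hx
      exact_mod_cast this
    obtain ⟨n, rfl⟩ := Int.eq_ofNat_of_zero_le hm0
    exact ⟨n, by rw [hm]; simp⟩
  obtain ⟨hc0, -⟩ := coeffC_two_mem (v := v) hk (by omega)
  -- In design terms `l` is the number of blocks through a pair and `r` the number through a point;
  -- `h1` and `h2` below are the classical counting identities.
  obtain ⟨l, hlt⟩ := nat_of _ (by rw [← coeffC_two]; positivity) hint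
  obtain ⟨r, hrt⟩ := nat_of _ (by positivity) hint'
  have h1 : l * (v - 1) = r * (k - 1) := by
    have : ((l * (v - 1) : ℕ) : ℝ) = ((r * (k - 1) : ℕ) : ℝ) := by
      rw [Nat.cast_mul, Nat.cast_mul, Nat.cast_pred (by omega), Nat.cast_pred (by omega), ← hlt,
        ← hrt]
      field_simp
    exact_mod_cast this
  have h2 : l * v.choose 2 = t * k.choose 2 := by
    have : ((l * v.choose 2 : ℕ) : ℝ) = ((t * k.choose 2 : ℕ) : ℝ) := by
      rw [Nat.cast_mul, Nat.cast_mul, ← hlt, ← ratio_mul_dim (v := v) (k := k) (by omega)]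
      ring
    exact_mod_cast this
  have htx : (t : ℝ) * (dim v * δ) ^ 3 ≤ 2 := by
    have : (0 : ℝ) < (dim v * δ) ^ 3 := by positivity
    rw [← div_eq_mul_inv, lt_div_iff₀ this] at htδ
    exact htδ.le
  have hmain := abs_le.1 (abs_returnProb_sub_le (t := t) (l := l) hk hvk hl hpq h1 h2
    (by rw [coeffC_two]; exact hlt) hδ hδ1 hδk)
  rw [card_pair' hl hpq] at hmain
  obtain ⟨P, hP, hPM, hsub⟩ := hD.2.2
  obtain ⟨hsub1, hsub2⟩ := hsub δ hδ
  have hlow := le_majorArc hk (by omega) hl hpq hD hP hPM hsub1 (by omega : 1 ≤ t) hδ hx htx hd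
  have hupp := majorArc_le hk (by omega) hl hpq hD hP hPM hsub2 (by omega : 1 ≤ t) hδ hx hd
  rw [← mainTerm_eq hP hPM (by omega : 1 ≤ t)]
  have hw : 0 ≤ ((2 * Real.pi) ^ (dim v - 1))⁻¹ * ((k : ℝ) - 1) ^ (v - 1) :=
    mul_nonneg (by positivity) (pow_nonneg (by linarith) _)
  have hlow' := mul_le_mul_of_nonneg_left hlow hw
  have hupp' := mul_le_mul_of_nonneg_left hupp hw
  constructor
  · linarith [hmain.2]
  · linarith [hmain.1]

end Bounds

end BIBDWalk

theorem mainTheorem2 (v k : ℕ) (hk : 2 ≤ k) (hvk : k + 2 ≤ v) :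
    (∃ D₁ D₂ : ℝ, BIBDWalk.IsScalingPair v k D₁ D₂) ∧
    ∀ (δ : ℝ) (t : ℕ), 0 < δ →
      δ < ((k : ℝ) ^ 2)⁻¹ * ((v.choose k : ℝ) ^ 2)⁻¹
        * (1 / (6 * 96 ^ 2) * (2 * Real.pi / ((k : ℝ) - 1)) ^ 4) →
      2 ≤ t → (t : ℝ) < 2 * (((BIBDWalk.dim v : ℝ) * δ) ^ 3)⁻¹ →
      ((¬ ∃ m : ℤ, (t : ℝ) * (((k : ℝ) * (k - 1)) / ((v : ℝ) * (v - 1))) = m) →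
        BIBDWalk.returnProb v k t = 0) ∧
      ((∃ m : ℤ, (t : ℝ) * (((k : ℝ) * (k - 1)) / ((v : ℝ) * (v - 1))) = m) →
        (¬ ∃ m : ℤ, (t : ℝ) * ((k : ℝ) / v) = m) →
        BIBDWalk.returnProb v k t ≤ BIBDWalk.errorTerm v k t δ) ∧
      ((∃ m : ℤ, (t : ℝ) * (((k : ℝ) * (k - 1)) / ((v : ℝ) * (v - 1))) = m) →
        (∃ m : ℤ, (t : ℝ) * ((k : ℝ) / v) = m) →
        ∀ D₁ D₂ : ℝ, BIBDWalk.IsScalingPair v k D₁ D₂ →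
          BIBDWalk.returnProb v k t ≤
            BIBDWalk.mainTerm v k t * BIBDWalk.factorU v t D₂ δ + BIBDWalk.errorTerm v k t δ ∧
          BIBDWalk.mainTerm v k t * BIBDWalk.factorL v t D₁ δ - BIBDWalk.errorTerm v k t δ ≤
            BIBDWalk.returnProb v k t) := by
  have hpq : (⟨v - 2, by omega⟩ : Fin v) ≠ ⟨v - 1, by omega⟩ := by
    rw [Ne, Fin.ext_iff]
    simp only
    omega
  refine ⟨BIBDWalk.exists_isScalingPair
    (BIBDWalk.matM_posDef hk hvk (BIBDWalk.lastPair_eq (by omega)) hpq), ?_⟩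
  intro δ t hδ hδs ht htδ
  refine ⟨fun h => ?_, fun _ h => ?_, fun h h' D₁ D₂ hD => ?_⟩
  · exact BIBDWalk.returnProb_eq_zero_of_forall fun ω hω =>
      h (BIBDWalk.exists_int_of_Y_eq_zero (by omega) hω)
  -- In this case the probability is exactly zero, so the exponential bound is immediate.
  · rw [BIBDWalk.returnProb_eq_zero_of_forall fun ω hω =>
      h (BIBDWalk.exists_int_of_Y_eq_zero' hk (by omega) hω)]
    exact Real.exp_nonneg _
  · exact BIBDWalk.returnProb_bounds hk hvk hδ hδs ht htδ h h' hD
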